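/- **Conventions.** A coarse structure $\mathcal E$ on a set $X$ is a collection of subsets of $X\times X$ (the controlled sets) that contains the diagonal and is closed under subsets, finite unions, compositions $E\circ F=\{(x,y):\exists z,\ (x,z)\in E,\ (z,y)\in F\}$ and inverses $E^{-1}=\{(x,y):(y,x)\in E\}$. It has bounded geometry if for each $E\in\mathcal E$ the sets $\{y:(x,y)\in E\cup E^{-1}\}$, $x\in X$, have uniformly bounded cardinality. A controlled set $E$ is generating if every controlled set is contained in some $n$-fold composition $E^{\circ n}$, $n\ge 1$. The coarse components are the classes of the equivalence relation "$\{(x,y)\}$ is controlled". A *space* is a set with a bounded geometry coarse structure that has a generating controlled set and at most countably many coarse components. The translation algebra $\mathbb C_u[X]$ is the unital $*$-algebra (matrix operations, conjugate transpose) of bounded matrices $(T_{xy})_{x,y\in X}$ over $\mathbb C$ whose support $\{(x,y):T_{xy}\ne 0\}$ is controlled. A partial translation is a bijection $t:A\to B$ between subsets of $X$ with controlled graph $\{(t(x),x):x\in A\}$; the corresponding operator $v\in\mathbb C_u[X]$ has $v_{xy}=1$ if $t(y)=x$ and $v_{xy}=0$ otherwise. A representation of $\mathbb C_u[X]$ is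 a unital $*$-homomorphism into the bounded operators on a complex Hilbert space $\mathcal H$; its closed subspace of constant vectors is $\mathcal H_c=\{\xi: v\xi=vv^*\xi \text{ for all partial translations } v\}$. The space $X$ has *geometric property (T)* if for every controlled generating set $E$ there is $c>0$ such that for every representation $\mathcal H$ and every $\xi\in\mathcal H_c^\perp$ there is a partial translation $v$ with support in $E$ and $\|(vv^*-v)\xi\|\ge c\|\xi\|$. Let $\beta X$ be the Stone–Čech compactification of the discrete set $X$ and $\partial X=\beta X\setminus X$. For $E\in\mathcal E$ let $\overline E$ be the closure of $E$ in $\beta X\times\beta X$ and $\partial E=\overline E\cap(\partial X\times\partial X)$. Let $\beta_{\mathcal E}X=\bigcup_{E\in\mathcal E}\overline E$ with the topology in which $U$ is open iff $U\cap\overline E$ is relatively open in $\overline E$ for all $E\in\mathcal E$, and let $\partial_{\mathcal E}X=\bigcup_{E\in\mathcal E}\partial E$ with the subspace topology from $\beta_{\mathcal E}X$. The space $X$ is *boundary a-T-menable* if there is a continuous function $k:\partial_{\mathcal E}X\to[0,\infty)$ that is - normalized: $k(\omega,\omega)=0$ whenever $(\omega,\omega)\in\partial_{\mathcal E}X$;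 - symmetric: $k(\omega_1,\omega_2)=k(\omega_2,\omega_1)$ for all $(\omega_1,\omega_2)\in\partial_{\mathcal E}X$; - of negative type: $\sum_{i,j=1}^n\overline{z_i}z_j\,k(\omega_i,\omega_j)\le 0$ whenever $(\omega_i,\omega_j)\in\partial_{\mathcal E}X$ for all $i,j$, and $z_1,\dots,z_n\in\mathbb C$ satisfy $\sum_i z_i=0$; - proper: $\lim_{E\in\mathcal E}\ \inf\{k(\omega_1,\omega_2):(\omega_1,\omega_2)\in\partial_{\mathcal E}X\setminus\partial E\}=\infty$, the limit being over the controlled sets directed by inclusion (with $\inf\varnothing=\infty$). **Theorem.** Let $X$ be a space that is the disjoint union $X=\bigsqcup_{n\in\mathbb N}X_n$ of its coarse components, where every $X_n$ is finite and $|X_n|\to\infty$ as $n\to\infty$. If $X$ is boundary a-T-menable, then $X$ does not have geometric property (T). -/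

import Mathlib

open Set Filter Topology
open scoped NNReal ENNReal InnerProductSpace

universe u

/-! ## Coarse structures -/

/-- Composition `E ∘ F` of two subsets of `X × X`. -/
def relComp {X : Type u} (E F : Set (X × X)) : Set (X × X) :=
  {p | ∃ z, (p.1, z) ∈ E ∧ (z, p.2) ∈ F}

/-- Inverse of a subset of `X × X`. -/
def relInv {X : Type u} (E : Set (X × X)) : Set (X × X) :=
  {p | (p.2, p.1) ∈ E}

/-- `relPow E n` is the `n`-fold composition of `E` with itself (the diagonal for `n = 0`). -/
def relPow {X : Type u} (E : Set (X × X)) : ℕ → Set (X × X)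
  | 0 => {p | p.1 = p.2}
  | n + 1 => relComp (relPow E n) E

/-- A (unital) coarse structure on a set `X`. -/
structure CoarseStructure (X : Type u) where
  /-- the controlled sets -/
  IsControlled : Set (X × X) → Prop
  diag : IsControlled {p | p.1 = p.2}
  subset : ∀ {E F : Set (X × X)}, IsControlled E → F ⊆ E → IsControlled F
  union : ∀ {E F : Set (X × X)}, IsControlled E → IsControlled F → IsControlled (E ∪ F)
  comp : ∀ {E F : Set (X × X)}, IsControlled E → IsControlled F → IsControlled (relComp E F)
  inv : ∀ {E : Set (X × X)}, IsControlled E → IsControlled (relInv E)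

namespace CoarseStructure

variable {X : Type u} (𝓔 : CoarseStructure X)

/-- The controlled sets as a type, ordered by inclusion. -/
abbrev Controlled : Type u := {E : Set (X × X) // 𝓔.IsControlled E}

/-- Bounded geometry: uniformly bounded slices of every controlled set. -/
def BoundedGeometry : Prop :=
  ∀ E, 𝓔.IsControlled E →
    ∃ M : ℕ, ∀ x : X, {y | (x, y) ∈ E ∪ relInv E}.encard ≤ (M : ℕ∞)

/-- `E` is a controlled generating set. -/
def IsGenerating (E : Set (X × X)) : Prop :=
  𝓔.IsControlled E ∧ ∀ F, 𝓔.IsControlled F → ∃ n : ℕ, 1 ≤ n ∧ F ⊆ relPow E n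

/-- The coarse component of `x`. -/
def component (x : X) : Set X := {y | 𝓔.IsControlled {(x, y)}}

/-- A *space*: a bounded geometry, monogenic coarse space with at most countably many
coarse components. -/
class IsSpace : Prop where
  boundedGeometry : 𝓔.BoundedGeometry
  monogenic : ∃ E, 𝓔.IsGenerating E
  countable_components : (Set.range 𝓔.component).Countable

/-- `X` is the disjoint union of the sequence `Y 0, Y 1, …` of its (pairwise distinct) coarse
components, all of them finite, with cardinality tending to infinity. -/
structure SplitsIntoFiniteComponents (Y : ℕ → Set X) : Prop where
  isComponent : ∀ n, ∃ x, Y n = 𝓔.component x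
  disjoint : Pairwise (Function.onFun Disjoint Y)
  cover : ⋃ n, Y n = Set.univ
  finite : ∀ n, (Y n).Finite
  card_tendsto : Tendsto (fun n => (Y n).ncard) atTop atTop

end CoarseStructure

/-! ## The translation algebra -/

/-- The translation algebra `ℂ_u[X]`: bounded `X × X` complex matrices with controlled support. -/
@[ext]
structure TranslationAlgebra {X : Type u} (𝓔 : CoarseStructure X) where
  /-- the matrix coefficients -/
  entry : X → X → ℂ
  bounded : ∃ C : ℝ, ∀ x y, ‖entry x y‖ ≤ C
  controlled : 𝓔.IsControlled {p | entry p.1 p.2 ≠ 0}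

namespace TranslationAlgebra

variable {X : Type u} {𝓔 : CoarseStructure X}

/-- The support of a matrix. -/
def supp (T : TranslationAlgebra 𝓔) : Set (X × X) := {p | T.entry p.1 p.2 ≠ 0}

noncomputable section

instance : Zero (TranslationAlgebra 𝓔) :=
  ⟨{ entry := fun _ _ => 0
     bounded := ⟨0, by simp⟩
     controlled := 𝓔.subset 𝓔.diag (by simp) }⟩

instance : Add (TranslationAlgebra 𝓔) :=
  ⟨fun S T =>
    { entry := fun x y => S.entry x y + T.entry x y
      bounded := by
        obtain ⟨C, hC⟩ := S.bounded
        obtain ⟨D, hD⟩ := T.bounded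
        exact ⟨C + D, fun x y => (norm_add_le _ _).trans (add_le_add (hC x y) (hD x y))⟩
      controlled := by
        refine 𝓔.subset (𝓔.union S.controlled T.controlled) ?_
        rintro ⟨x, y⟩ h
        by_contra h'
        simp only [mem_union, mem_ofPred_eq, not_or, not_not] at h h'
        exact h (by rw [h'.1, h'.2, add_zero]) }⟩

instance : SMul ℂ (TranslationAlgebra 𝓔) :=
  ⟨fun c T =>
    { entry := fun x y => c * T.entry x y
      bounded := by
        obtain ⟨C, hC⟩ := T.bounded
        exact ⟨‖c‖ * C, fun x y => by
          rw [norm_mul]; exact mul_le_mul_of_nonneg_left (hC x y) (norm_nonneg _)⟩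
      controlled := 𝓔.subset T.controlled fun _ h => right_ne_zero_of_mul h }⟩

instance : Neg (TranslationAlgebra 𝓔) :=
  ⟨fun T =>
    { entry := fun x y => -T.entry x y
      bounded := by simpa using T.bounded
      controlled := by simpa using T.controlled }⟩

/-- The adjoint is the conjugate transpose. -/
instance : Star (TranslationAlgebra 𝓔) :=
  ⟨fun T =>
    { entry := fun x y => star (T.entry y x)
      bounded := by
        obtain ⟨C, hC⟩ := T.bounded
        exact ⟨C, fun x y => by rw [norm_star]; exact hC y x⟩
      controlled := 𝓔.subset (𝓔.inv T.controlled) fun p (h : star _ ≠ (0 : ℂ)) =>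
        show T.entry p.2 p.1 ≠ 0 from star_ne_zero.1 h }⟩

open Classical in
/-- The identity matrix. -/
instance : One (TranslationAlgebra 𝓔) :=
  ⟨{ entry := fun x y => if x = y then 1 else 0
     bounded := ⟨1, fun x y => by split_ifs <;> simp⟩
     controlled := 𝓔.subset 𝓔.diag fun p h => by
       by_contra h'
       exact h (if_neg h') }⟩

@[simp] theorem zero_entry (x y : X) : (0 : TranslationAlgebra 𝓔).entry x y = 0 := rfl

@[simp] theorem add_entry (S T : TranslationAlgebra 𝓔) (x y : X) :
    (S + T).entry x y = S.entry x y + T.entry x y := rfl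

@[simp] theorem neg_entry (T : TranslationAlgebra 𝓔) (x y : X) :
    (-T).entry x y = -T.entry x y := rfl

@[simp] theorem smul_entry (c : ℂ) (T : TranslationAlgebra 𝓔) (x y : X) :
    (c • T).entry x y = c * T.entry x y := rfl

@[simp] theorem star_entry (T : TranslationAlgebra 𝓔) (x y : X) :
    (star T).entry x y = star (T.entry y x) := rfl

open Classical in
theorem one_entry (x y : X) : (1 : TranslationAlgebra 𝓔).entry x y = if x = y then 1 else 0 := rfl

theorem finsum_row {S : TranslationAlgebra 𝓔} {x : X} {s : Finset X}
    (hs : ∀ y, y ∉ s → S.entry x y = 0) (f : X → ℂ) :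
    ∑ᶠ y, S.entry x y * f y = ∑ y ∈ s, S.entry x y * f y := by
  refine finsum_eq_sum_of_support_subset _ fun y hy => ?_
  by_contra h
  exact hy (by simp [hs y (by simpa using h)])

variable [h𝓔 : 𝓔.IsSpace]

theorem exists_row_bound (T : TranslationAlgebra 𝓔) :
    ∃ M : ℕ, ∀ x, ∃ s : Finset X, s.card ≤ M ∧ ∀ y, T.entry x y ≠ 0 → y ∈ s := by
  obtain ⟨M, hM⟩ := h𝓔.boundedGeometry _ T.controlled
  refine ⟨M, fun x => ?_⟩
  have hfin : {y | (x, y) ∈ {p : X × X | T.entry p.1 p.2 ≠ 0} ∪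
      relInv {p : X × X | T.entry p.1 p.2 ≠ 0}}.Finite :=
    Set.finite_of_encard_le_coe (hM x)
  refine ⟨hfin.toFinset, ?_, fun y hy => ?_⟩
  · have := hM x
    rw [hfin.encard_eq_coe_toFinset_card] at this
    exact_mod_cast this
  · rw [Set.Finite.mem_toFinset]
    exact Or.inl hy

/-- Rows have finite support. -/
theorem exists_row_finset (T : TranslationAlgebra 𝓔) (x : X) :
    ∃ s : Finset X, ∀ y, y ∉ s → T.entry x y = 0 := by
  obtain ⟨M, hM⟩ := T.exists_row_bound
  obtain ⟨s, -, hs⟩ := hM x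
  exact ⟨s, fun y hy => by by_contra h; exact hy (hs y h)⟩

/-- Matrix multiplication; the sum has finitely many non-zero terms by bounded geometry. -/
instance : Mul (TranslationAlgebra 𝓔) :=
  ⟨fun S T =>
    { entry := fun x z => ∑ᶠ y, S.entry x y * T.entry y z
      bounded := by
        obtain ⟨C, hC⟩ := S.bounded
        obtain ⟨D, hD⟩ := T.bounded
        obtain ⟨M, hM⟩ := S.exists_row_bound
        refine ⟨M * (|C| * |D|), fun x z => ?_⟩
        obtain ⟨s, hcard, hs⟩ := hM x
        rw [finsum_row (s := s) (fun y hy => by by_contra h; exact hy (hs y h))]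
        refine (norm_sum_le _ _).trans ((Finset.sum_le_card_nsmul s _ (|C| * |D|) ?_).trans ?_)
        · intro y _
          rw [norm_mul]
          exact mul_le_mul ((hC x y).trans (le_abs_self _)) ((hD y z).trans (le_abs_self _))
            (norm_nonneg _) (abs_nonneg _)
        · rw [nsmul_eq_mul]
          exact mul_le_mul_of_nonneg_right (by exact_mod_cast hcard) (by positivity)
      controlled := by
        refine 𝓔.subset (𝓔.comp S.controlled T.controlled) ?_
        rintro ⟨x, z⟩ h
        have h' : ∃ y, S.entry x y * T.entry y z ≠ 0 := by
          by_contra! h'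
          exact h (by simp [h'])
        obtain ⟨y, hy⟩ := h'
        exact ⟨y, left_ne_zero_of_mul hy, right_ne_zero_of_mul hy⟩ }⟩

theorem mul_entry (S T : TranslationAlgebra 𝓔) (x z : X) :
    (S * T).entry x z = ∑ᶠ y, S.entry x y * T.entry y z := rfl

theorem mul_entry_eq_sum {S : TranslationAlgebra 𝓔} (T : TranslationAlgebra 𝓔) {x : X}
    {s : Finset X} (hs : ∀ y, y ∉ s → S.entry x y = 0) (z : X) :
    (S * T).entry x z = ∑ y ∈ s, S.entry x y * T.entry y z :=
  finsum_row hs _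

protected theorem mul_assoc' (R S T : TranslationAlgebra 𝓔) : R * S * T = R * (S * T) := by
  classical
  ext x w
  obtain ⟨s, hs⟩ := R.exists_row_finset x
  choose t ht using S.exists_row_finset
  have hy : ∀ y ∈ s, ∀ z, z ∉ s.biUnion t → S.entry y z = 0 := fun y hy z hz =>
    ht y z fun h => hz (Finset.mem_biUnion.2 ⟨y, hy, h⟩)
  have hRS : ∀ z, z ∉ s.biUnion t → (R * S).entry x z = 0 := by
    intro z hz
    rw [mul_entry_eq_sum S hs]
    exact Finset.sum_eq_zero fun y hys => by rw [hy y hys z hz, mul_zero]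
  rw [mul_entry_eq_sum T hRS, mul_entry_eq_sum (S * T) hs]
  have h1 : ∀ y ∈ s, R.entry x y * (S * T).entry y w =
      ∑ z ∈ s.biUnion t, R.entry x y * S.entry y z * T.entry z w := by
    intro y hys
    rw [mul_entry_eq_sum T (hy y hys), Finset.mul_sum]
    exact Finset.sum_congr rfl fun z _ => (mul_assoc _ _ _).symm
  rw [Finset.sum_congr rfl h1, Finset.sum_comm]
  refine Finset.sum_congr rfl fun z _ => ?_
  rw [mul_entry_eq_sum S hs, Finset.sum_mul]

instance : Ring (TranslationAlgebra 𝓔) where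
  add_assoc R S T := by ext x y; simp [add_assoc]
  zero_add T := by ext x y; simp
  add_zero T := by ext x y; simp
  add_comm S T := by ext x y; simp [add_comm]
  neg_add_cancel T := by ext x y; simp
  nsmul := nsmulRec
  zsmul := zsmulRec
  mul_assoc := TranslationAlgebra.mul_assoc'
  zero_mul T := by ext x z; simp [mul_entry]
  mul_zero T := by ext x z; simp [mul_entry]
  left_distrib R S T := by
    ext x z
    obtain ⟨s, hs⟩ := R.exists_row_finset x
    simp [mul_entry_eq_sum _ hs, mul_add, Finset.sum_add_distrib]
  right_distrib R S T := by
    classical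
    ext x z
    obtain ⟨s, hs⟩ := R.exists_row_finset x
    obtain ⟨t, ht⟩ := S.exists_row_finset x
    have hR : ∀ y, y ∉ s ∪ t → R.entry x y = 0 := fun y hy => hs y (by simp_all)
    have hS : ∀ y, y ∉ s ∪ t → S.entry x y = 0 := fun y hy => ht y (by simp_all)
    have hRS : ∀ y, y ∉ s ∪ t → (R + S).entry x y = 0 := fun y hy => by
      simp [hR y hy, hS y hy]
    rw [add_entry, mul_entry_eq_sum _ hRS, mul_entry_eq_sum _ hR, mul_entry_eq_sum _ hS]
    simp [add_mul, Finset.sum_add_distrib]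
  one_mul T := by
    classical
    ext x z
    have h1 : ∀ y, y ∉ ({x} : Finset X) → (1 : TranslationAlgebra 𝓔).entry x y = 0 :=
      fun y hy => by simp [one_entry, Ne.symm (by simpa using hy : y ≠ x)]
    simp [mul_entry_eq_sum _ h1, one_entry]
  mul_one T := by
    ext x z
    rw [mul_entry, finsum_eq_single _ z]
    · simp [one_entry]
    · intro y hy
      simp [one_entry, hy]

instance : Module ℂ (TranslationAlgebra 𝓔) where
  one_smul T := by ext x y; simp
  mul_smul c d T := by ext x y; simp [mul_assoc]
  smul_zero c := by ext x y; simp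
  smul_add c S T := by ext x y; simp [mul_add]
  add_smul c d T := by ext x y; simp [add_mul]
  zero_smul T := by ext x y; simp

instance : Algebra ℂ (TranslationAlgebra 𝓔) :=
  Algebra.ofModule
    (fun c S T => by
      ext x z
      obtain ⟨s, hs⟩ := S.exists_row_finset x
      have hcS : ∀ y, y ∉ s → (c • S).entry x y = 0 := fun y hy => by simp [hs y hy]
      simp [mul_entry_eq_sum _ hs, mul_entry_eq_sum _ hcS, Finset.mul_sum, mul_assoc])
    (fun c S T => by
      ext x z
      obtain ⟨s, hs⟩ := S.exists_row_finset x
      simp [mul_entry_eq_sum _ hs, Finset.mul_sum, mul_left_comm])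

instance : StarRing (TranslationAlgebra 𝓔) where
  star_involutive T := by ext x y; simp
  star_mul S T := by
    ext x z
    rw [star_entry, mul_entry, mul_entry]
    change starAddEquiv _ = _
    rw [AddEquiv.map_finsum]
    refine finsum_congr fun y => ?_
    simp [mul_comm]
  star_add S T := by ext x y; simp

instance : StarModule ℂ (TranslationAlgebra 𝓔) where
  star_smul c T := by ext x y; simp

end

end TranslationAlgebra

/-! ## Partial translations -/

/-- A partial translation: a bijection `t : A → B` between subsets of `X` whose graph
`{(t x, x) | x ∈ A}` is controlled. -/
structure PartialTranslation {X : Type u} (𝓔 : CoarseStructure X) where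
  /-- the partial bijection -/
  toPEquiv : X ≃. X
  controlled : 𝓔.IsControlled {p | toPEquiv p.2 = some p.1}

namespace PartialTranslation

variable {X : Type u} {𝓔 : CoarseStructure X}

open Classical in
/-- The partial translation operator `v`, with `v x y = 1` if `t y = x` and `0` otherwise. -/
noncomputable def op (t : PartialTranslation 𝓔) : TranslationAlgebra 𝓔 where
  entry x y := if t.toPEquiv y = some x then 1 else 0
  bounded := ⟨1, fun x y => by split_ifs <;> simp⟩
  controlled := 𝓔.subset t.controlled fun p h => by
    by_contra h'
    exact h (if_neg h')

end PartialTranslation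

/-! ## Representations, constant vectors, geometric property (T) -/

section Representations

variable {X : Type u} {𝓔 : CoarseStructure X} [𝓔.IsSpace]
  {H : Type u} [NormedAddCommGroup H] [InnerProductSpace ℂ H] [CompleteSpace H]

/-- The constant (invariant) vectors of a representation: `v ξ = v v* ξ` for every partial
translation `v`. -/
def constantVectors (π : TranslationAlgebra 𝓔 →⋆ₐ[ℂ] (H →L[ℂ] H)) : Submodule ℂ H where
  carrier := {ξ | ∀ t : PartialTranslation 𝓔, π t.op ξ = π (t.op * star t.op) ξ}
  add_mem' := fun {a b} ha hb t => by rw [_root_.map_add, _root_.map_add, ha t, hb t]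
  zero_mem' := fun t => by rw [_root_.map_zero, _root_.map_zero]
  smul_mem' := fun c a ha t => by rw [_root_.map_smul, _root_.map_smul, ha t]

end Representations

/-- Geometric property (T).  Representations are unital `*`-homomorphisms into the bounded
operators on a complex Hilbert space. -/
def GeometricPropertyT {X : Type u} (𝓔 : CoarseStructure X) [𝓔.IsSpace] : Prop :=
  ∀ E, 𝓔.IsGenerating E → ∃ c : ℝ, 0 < c ∧
    ∀ (H : Type u) [NormedAddCommGroup H] [InnerProductSpace ℂ H] [CompleteSpace H]
      (π : TranslationAlgebra 𝓔 →⋆ₐ[ℂ] (H →L[ℂ] H)),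
      ∀ ξ ∈ (constantVectors π)ᗮ, ∃ t : PartialTranslation 𝓔,
        t.op.supp ⊆ E ∧ c * ‖ξ‖ ≤ ‖π (t.op * star t.op - t.op) ξ‖

/-! ## The boundary part of the coarse groupoid

The Stone-Čech compactification of the discrete space `X` is the space `Ultrafilter X`, with `X`
embedded as the principal ultrafilters `pure x`. -/

/-- The Stone-Čech corona of the discrete space `X`: the non-principal ultrafilters. -/
def corona (X : Type u) : Set (Ultrafilter X) := (Set.range (pure : X → Ultrafilter X))ᶜ

/-- The closure of `E ⊆ X × X` in the square of the Stone-Čech compactification. -/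
def betaClosure {X : Type u} (E : Set (X × X)) : Set (Ultrafilter X × Ultrafilter X) :=
  closure ((fun p : X × X => ((pure p.1, pure p.2) : Ultrafilter X × Ultrafilter X)) '' E)

/-- `∂E`, the part of the closure of `E` lying over the corona. -/
def boundaryClosure {X : Type u} (E : Set (X × X)) : Set (Ultrafilter X × Ultrafilter X) :=
  betaClosure E ∩ (corona X ×ˢ corona X)

namespace CoarseStructure

variable {X : Type u} (𝓔 : CoarseStructure X)

/-- The space `β_𝓔 X`: the union of the closures of all controlled sets. -/
@[ext]
structure Beta where
  /-- first coordinate -/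
  fst : Ultrafilter X
  /-- second coordinate -/
  snd : Ultrafilter X
  mem : ∃ E, 𝓔.IsControlled E ∧ (fst, snd) ∈ betaClosure E

/-- The inclusion of the closure of a controlled set in `β_𝓔 X`. -/
def betaIncl (E : 𝓔.Controlled) (p : betaClosure E.1) : 𝓔.Beta :=
  ⟨p.1.1, p.1.2, E.1, E.2, p.2⟩

/-- The weak topology on `β_𝓔 X`: a set is open iff its intersection with the closure of every
controlled set `E` is open in that closure. -/
instance : TopologicalSpace 𝓔.Beta :=
  ⨆ E : 𝓔.Controlled, TopologicalSpace.coinduced (𝓔.betaIncl E) inferInstance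

theorem isOpen_beta_iff {U : Set 𝓔.Beta} :
    IsOpen U ↔ ∀ E : 𝓔.Controlled, IsOpen (𝓔.betaIncl E ⁻¹' U) := by
  change IsOpen[⨆ E : 𝓔.Controlled, TopologicalSpace.coinduced (𝓔.betaIncl E) _] U ↔ _
  simp only [isOpen_iSup_iff, isOpen_coinduced]

/-- The space `∂_𝓔 X`: the union of the sets `∂E` over all controlled sets. -/
@[ext]
structure Boundary where
  /-- first coordinate -/
  fst : Ultrafilter X
  /-- second coordinate -/
  snd : Ultrafilter X
  mem : ∃ E, 𝓔.IsControlled E ∧ (fst, snd) ∈ boundaryClosure E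

/-- The inclusion of `∂_𝓔 X` in `β_𝓔 X`. -/
def Boundary.toBeta (p : 𝓔.Boundary) : 𝓔.Beta :=
  ⟨p.fst, p.snd, p.mem.imp fun _ h => ⟨h.1, h.2.1⟩⟩

/-- The subspace topology. -/
instance : TopologicalSpace 𝓔.Boundary :=
  TopologicalSpace.induced (Boundary.toBeta 𝓔) inferInstance

/-- The flip map of `∂_𝓔 X`. -/
def Boundary.flip (p : 𝓔.Boundary) : 𝓔.Boundary :=
  ⟨p.snd, p.fst, by
    obtain ⟨E, hE, h1, h2⟩ := p.mem
    refine ⟨relInv E, 𝓔.inv hE, ?_, h2.2, h2.1⟩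
    have := mem_closure_image (f := Prod.swap) continuous_swap.continuousAt h1
    refine closure_mono ?_ this
    rintro _ ⟨_, ⟨q, hq, rfl⟩, rfl⟩
    exact ⟨(q.2, q.1), hq, rfl⟩⟩

/-- A continuous, proper, normalized, symmetric function of negative type on `∂_𝓔 X`. -/
structure IsProperNegativeTypeKernel (k : 𝓔.Boundary → ℝ≥0) : Prop where
  continuous : Continuous k
  normalized : ∀ p : 𝓔.Boundary, p.fst = p.snd → k p = 0
  symmetric : ∀ p : 𝓔.Boundary, k (Boundary.flip 𝓔 p) = k p
  negativeType : ∀ (n : ℕ) (ω : Fin n → Ultrafilter X)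
    (h : ∀ i j, ∃ E, 𝓔.IsControlled E ∧ (ω i, ω j) ∈ boundaryClosure E) (z : Fin n → ℂ),
    ∑ i, z i = 0 →
      (∑ i, ∑ j, star (z i) * z j * ((k ⟨ω i, ω j, h i j⟩ : ℝ) : ℂ)).re ≤ 0
  proper : Tendsto
    (fun E : 𝓔.Controlled =>
      ⨅ p : {p : 𝓔.Boundary // (p.fst, p.snd) ∉ boundaryClosure E.1}, (k p.1 : ℝ≥0∞))
    atTop (𝓝 ⊤)

/-- Boundary a-T-menability. -/
def BoundaryATMenable : Prop := ∃ k : 𝓔.Boundary → ℝ≥0, 𝓔.IsProperNegativeTypeKernel k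

end CoarseStructure

/-!
# Boundary a-T-menability excludes geometric property (T)

A kernel `k` of negative type on the boundary gives, by Schoenberg's theorem
(`sum_exp_neg_mul_nonneg`), kernels `exp (-τ k)` of positive type. Each defines a positive
functional on the translation algebra: spread `k` to a function `κ` on `X × X` that has the values
of `k` as limits at infinity (`IsProperNegativeTypeKernel.exists_isExtensionOf`, from Tietze's
theorem), and send a matrix `T` to the limit, along a non-principal ultrafilter, of the averages
over the components of the row sums of `T x y * exp (-τ κ x y)`
(`SplitsIntoFiniteComponents.exists_limit_functional`). The function `κ` is of negative type only
asymptotically, but finite sets of rows are negligible in the limit, so an ultrafilter argument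
(`IsProperNegativeTypeKernel.finite_rowForm_lt`) yields positivity. The functional is dominated by
the submultiplicative norm `rowNorm`, which is enough for the Gelfand–Naimark–Segal construction
(`DominatedPositiveFunctional.rep`).

Let `ξ` be the cyclic vector and `v` the operator of a partial translation `t`. Then
`‖(v v* - v) ξ‖ ^ 2` is the limit of the averages of `2 - 2 * exp (-τ κ (t y) y)` over the points
`t y` of the range (and `0` off the range). For small `τ` this is small for all `v` supported in a
generating set, since `κ` is bounded there; under geometric property (T), `ξ` is then close to a
constant vector, and so `(v v* - v) ξ` is small for every partial translation. However, since the
components are connected graphs of bounded degree with cardinality tending to infinity, there is a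
partial translation that moves half of almost every component off any given controlled set
(`SplitsIntoFiniteComponents.exists_far_partialTranslation`), and by properness of `k` such a
partial translation makes `2 - 2 * exp (-τ κ (t y) y)` at least `3 / 2` on its range, up to
finitely many points (`IsExtensionOf.finite_lt`). This is a contradiction.
-/

/-! ### The Gelfand–Naimark–Segal construction -/

/-- A positive functional on a unital `*`-algebra that is dominated by a submultiplicative
function `size`. Domination replaces the completeness of the algebra: it forces left
multiplication to be bounded in the associated Hilbert space. -/
structure DominatedPositiveFunctional (A : Type u) [Ring A] [StarRing A] [Algebra ℂ A] where
  /-- the functional -/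
  toLinear : A →ₗ[ℂ] ℂ
  /-- the dominating function -/
  size : A → ℝ
  map_star : ∀ a, toLinear (star a) = star (toLinear a)
  nonneg : ∀ a, 0 ≤ (toLinear (star a * a)).re
  norm_le_size : ∀ a, ‖toLinear a‖ ≤ size a
  size_mul_le : ∀ a b, size (a * b) ≤ size a * size b

namespace DominatedPositiveFunctional

variable {A : Type u} [Ring A] [StarRing A] [Algebra ℂ A]

set_option linter.unusedVariables false in
/-- The algebra `A` as a pre-Hilbert space, with `⟪a, b⟫ = φ (star a * b)`. -/
@[nolint unusedArguments]
def PreHilbert (φ : DominatedPositiveFunctional A) : Type u := A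

variable (φ : DominatedPositiveFunctional A)

noncomputable section

instance : AddCommGroup φ.PreHilbert := inferInstanceAs (AddCommGroup A)
instance : Module ℂ φ.PreHilbert := inferInstanceAs (Module ℂ A)

/-- The identity map from the algebra to its pre-Hilbert space. -/
def toPre : A ≃ₗ[ℂ] φ.PreHilbert := LinearEquiv.refl ℂ _

/-- The identity map from the pre-Hilbert space to the algebra. -/
def ofPre : φ.PreHilbert ≃ₗ[ℂ] A := φ.toPre.symm

@[simp] lemma toPre_ofPre (a : φ.PreHilbert) : φ.toPre (φ.ofPre a) = a := rfl

@[simp] lemma ofPre_toPre (a : A) : φ.ofPre (φ.toPre a) = a := rfl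

lemma size_nonneg (a : A) : 0 ≤ φ.size a := (norm_nonneg _).trans (φ.norm_le_size a)

lemma size_pow_le (a : A) (m : ℕ) (c : A) :
    φ.size (a ^ m * c) ≤ φ.size a ^ m * φ.size c := by
  induction m with
  | zero => simp
  | succ m ih =>
    rw [pow_succ', mul_assoc, pow_succ', mul_assoc]
    exact (φ.size_mul_le _ _).trans (mul_le_mul_of_nonneg_left ih (φ.size_nonneg a))

variable [StarModule ℂ A]

/-- The positive semidefinite form `φ (star a * b)`. -/
abbrev preCore : PreInnerProductSpace.Core ℂ φ.PreHilbert where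
  inner a b := φ.toLinear (star (φ.ofPre a) * φ.ofPre b)
  conj_inner_symm a b := by
    rw [← Complex.star_def, ← φ.map_star]
    simp
  re_inner_nonneg a := φ.nonneg _
  add_left _ _ _ := by rw [map_add, star_add, add_mul, map_add]
  smul_left := by simp

instance : SeminormedAddCommGroup φ.PreHilbert :=
  InnerProductSpace.Core.toSeminormedAddCommGroup (c := φ.preCore)
instance : InnerProductSpace ℂ φ.PreHilbert :=
  InnerProductSpace.ofCore φ.preCore

lemma inner_def (a b : φ.PreHilbert) :
    ⟪a, b⟫_ℂ = φ.toLinear (star (φ.ofPre a) * φ.ofPre b) := rfl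

lemma inner_toPre (a b : A) :
    ⟪φ.toPre a, φ.toPre b⟫_ℂ = φ.toLinear (star a * b) := rfl

lemma norm_toPre_sq (a : A) : ‖φ.toPre a‖ ^ 2 = (φ.toLinear (star a * a)).re :=
  norm_sq_eq_re_inner (𝕜 := ℂ) (φ.toPre a)

lemma norm_sq_le_of_isSelfAdjoint {h : A} (hh : IsSelfAdjoint h) (m : ℕ) (x : A) :
    ‖φ.toPre (h ^ m * x)‖ ^ 2 ≤ ‖φ.toPre x‖ * ‖φ.toPre (h ^ (2 * m) * x)‖ := by
  have : star (h ^ m * x) * (h ^ m * x) = star x * (h ^ (2 * m) * x) := by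
    rw [star_mul, (hh.pow m).star_eq, two_mul, pow_add]
    simp only [mul_assoc]
  rw [norm_toPre_sq, this, ← inner_toPre]
  exact (Complex.re_le_norm _).trans (norm_inner_le_norm _ _)

/-- The spectral radius argument: iterating the Cauchy–Schwarz inequality bounds
`‖h x‖ / ‖x‖` by the `2 ^ n`-th root of `C * size h ^ 2 ^ n` for every `n`, hence by `size h`. -/
lemma norm_mul_le_of_isSelfAdjoint {h : A} (hh : IsSelfAdjoint h) (x : A) :
    ‖φ.toPre (h * x)‖ ≤ φ.size h * ‖φ.toPre x‖ := by
  have hD := φ.size_nonneg h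
  rcases (norm_nonneg (φ.toPre x)).eq_or_lt with h0 | hx
  · have := φ.norm_sq_le_of_isSelfAdjoint hh 1 x
    rw [← h0, zero_mul, pow_one] at this
    rw [← h0, mul_zero]
    exact (pow_eq_zero_iff two_ne_zero).1 (le_antisymm this (sq_nonneg _)) |>.le
  set N := ‖φ.toPre x‖ with hN
  set r := ‖φ.toPre (h * x)‖ / N with hr
  have hr0 : 0 ≤ r := by positivity
  obtain ⟨C, hC, hCb⟩ : ∃ C : ℝ, 0 ≤ C ∧ ∀ m, ‖φ.toPre (h ^ m * x)‖ / N ≤ C * φ.size h ^ m := by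
    refine ⟨√(φ.size (star x) * φ.size x) / N, by positivity, fun m => ?_⟩
    rw [div_mul_eq_mul_div]
    refine div_le_div_of_nonneg_right ?_ hx.le
    refine abs_le_of_sq_le_sq' ?_ (by positivity) |>.2
    rw [mul_pow, Real.sq_sqrt (mul_nonneg (φ.size_nonneg _) (φ.size_nonneg _)), norm_toPre_sq]
    refine (Complex.re_le_norm _).trans ((φ.norm_le_size _).trans ?_)
    have : star (h ^ m * x) * (h ^ m * x) = star x * (h ^ (2 * m) * x) := by
      rw [star_mul, (hh.pow m).star_eq, two_mul, pow_add]
      simp only [mul_assoc]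
    rw [this]
    refine (φ.size_mul_le _ _).trans ?_
    rw [mul_assoc, ← pow_mul, mul_comm m 2, mul_comm (φ.size x)]
    exact mul_le_mul_of_nonneg_left (φ.size_pow_le _ _ _) (φ.size_nonneg _)
  have hpow : ∀ n : ℕ, r ^ 2 ^ n ≤ ‖φ.toPre (h ^ 2 ^ n * x)‖ / N := by
    intro n
    induction n with
    | zero => simp [hr]
    | succ n ih =>
      rw [pow_succ, pow_mul]
      refine (pow_le_pow_left₀ (by positivity) ih 2).trans ?_
      rw [div_pow, div_le_div_iff₀ (by positivity) hx]
      have := φ.norm_sq_le_of_isSelfAdjoint hh (2 ^ n) x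
      rw [mul_comm 2] at this
      nlinarith [this, hx]
  have hmain : r ≤ φ.size h := by
    by_contra! hlt
    have hrpos : 0 < r := hD.trans_lt hlt
    rcases hD.eq_or_lt with h0 | hDpos
    · have := (hpow 0).trans (hCb _)
      simp only [pow_zero, pow_one, ← h0, mul_zero] at this
      exact absurd this (not_le.2 hrpos)
    · have h1 : 1 < r / φ.size h := (one_lt_div hDpos).2 hlt
      obtain ⟨n, hn⟩ := (tendsto_pow_atTop_atTop_of_one_lt h1).eventually_gt_atTop C
        |>.and (eventually_ge_atTop 0) |>.exists
      have h2 := (hpow n).trans (hCb _)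
      have h3 : (r / φ.size h) ^ 2 ^ n ≤ C := by
        rw [div_pow, div_le_iff₀ (by positivity)]
        exact h2
      have h4 : (r / φ.size h) ^ n ≤ (r / φ.size h) ^ 2 ^ n :=
        pow_le_pow_right₀ h1.le (Nat.lt_two_pow_self).le
      exact absurd (h4.trans h3) (not_le.2 hn.1)
  rwa [hr, div_le_iff₀ hx] at hmain

lemma norm_mul_sq_le (a x : A) :
    ‖φ.toPre (a * x)‖ ^ 2 ≤ φ.size (star a * a) * ‖φ.toPre x‖ ^ 2 := by
  have h1 : star (a * x) * (a * x) = star x * (star a * a * x) := by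
    rw [star_mul]; simp only [mul_assoc]
  rw [norm_toPre_sq, h1, ← inner_toPre]
  refine (Complex.re_le_norm _).trans ((norm_inner_le_norm _ _).trans ?_)
  have := φ.norm_mul_le_of_isSelfAdjoint (IsSelfAdjoint.star_mul_self a) x
  calc _ ≤ ‖φ.toPre x‖ * (φ.size (star a * a) * ‖φ.toPre x‖) :=
        mul_le_mul_of_nonneg_left this (norm_nonneg _)
    _ = _ := by ring

lemma norm_mul_le (a x : A) :
    ‖φ.toPre (a * x)‖ ≤ √(φ.size (star a * a)) * ‖φ.toPre x‖ := by
  refine abs_le_of_sq_le_sq' ?_ (by positivity) |>.2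
  rw [mul_pow, Real.sq_sqrt (φ.size_nonneg _)]
  exact φ.norm_mul_sq_le a x

/-- Left multiplication on the pre-Hilbert space. -/
def leftMul (a : A) : φ.PreHilbert →L[ℂ] φ.PreHilbert :=
  (φ.toPre.toLinearMap ∘ₗ LinearMap.mulLeft ℂ a ∘ₗ φ.ofPre.toLinearMap).mkContinuous
    (√(φ.size (star a * a))) fun x => φ.norm_mul_le a (φ.ofPre x)

@[simp] lemma leftMul_toPre (a b : A) : φ.leftMul a (φ.toPre b) = φ.toPre (a * b) := rfl

lemma leftMul_apply (a : A) (b : φ.PreHilbert) :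
    φ.leftMul a b = φ.toPre (a * φ.ofPre b) := rfl

open UniformSpace Completion in
/-- The representation by left multiplication on the completed pre-Hilbert space. -/
def rep : A →⋆ₐ[ℂ] (Completion φ.PreHilbert →L[ℂ] Completion φ.PreHilbert) where
  toFun a := (φ.leftMul a).completion
  map_one' := by
    ext c
    induction c using induction_on with
    | hp => apply isClosed_eq <;> fun_prop
    | ih c => simp [leftMul_apply]
  map_zero' := by
    ext c
    induction c using induction_on with
    | hp => apply isClosed_eq <;> fun_prop
    | ih c => simp [leftMul_apply, UniformSpace.Completion.coe_zero]
  map_add' _ _ := by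
    ext c
    induction c using induction_on with
    | hp => apply isClosed_eq <;> fun_prop
    | ih c => simp [leftMul_apply, add_mul, Completion.coe_add]
  map_mul' _ _ := by
    ext c
    induction c using induction_on with
    | hp => apply isClosed_eq <;> fun_prop
    | ih c => simp [leftMul_apply, mul_assoc]
  commutes' r := by
    ext c
    induction c using induction_on with
    | hp => apply isClosed_eq <;> fun_prop
    | ih c => simp [leftMul_apply, Algebra.algebraMap_eq_smul_one]
  map_star' a := by
    refine (ContinuousLinearMap.eq_adjoint_iff (φ.leftMul (star a)).completion
      (φ.leftMul a).completion).mpr ?_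
    intro x y
    induction x, y using induction_on₂ with
    | hp => apply isClosed_eq <;> fun_prop
    | ih x y => simp [leftMul_apply, mul_assoc, inner_def]

lemma rep_coe (a : A) (b : φ.PreHilbert) :
    φ.rep a (b : UniformSpace.Completion φ.PreHilbert) = (φ.leftMul a b : φ.PreHilbert) :=
  ContinuousLinearMap.completion_apply_coe (φ.leftMul a) b

/-- The cyclic vector of the representation, the class of `1`. -/
def cyclicVector : UniformSpace.Completion φ.PreHilbert := (φ.toPre 1 : φ.PreHilbert)

lemma norm_rep_cyclicVector_sq (a : A) :
    ‖φ.rep a φ.cyclicVector‖ ^ 2 = (φ.toLinear (star a * a)).re := by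
  rw [cyclicVector, rep_coe, UniformSpace.Completion.norm_coe, leftMul_toPre, norm_toPre_sq,
    mul_one]

lemma norm_rep_sq_le (a : A) (x : UniformSpace.Completion φ.PreHilbert) :
    ‖φ.rep a x‖ ^ 2 ≤ φ.size (star a * a) * ‖x‖ ^ 2 := by
  induction x using UniformSpace.Completion.induction_on with
  | hp => exact isClosed_le (by fun_prop) (by fun_prop)
  | ih x =>
    rw [rep_coe, UniformSpace.Completion.norm_coe, UniformSpace.Completion.norm_coe]
    exact φ.norm_mul_sq_le a (φ.ofPre x)

end

end DominatedPositiveFunctional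

/-! ### Schoenberg's theorem -/

open scoped Matrix ComplexOrder MatrixOrder in
/-- The entrywise exponential of a positive semidefinite matrix is positive semidefinite, by the
Schur product theorem applied to the terms of the exponential series. -/
theorem Matrix.PosSemidef.map_rexp {ι : Type*} [Fintype ι] {K : Matrix ι ι ℝ}
    (hK : K.PosSemidef) : (K.map Real.exp).PosSemidef := by
  classical
  have hpow : ∀ m : ℕ, (K.map (· ^ m)).PosSemidef := by
    intro m
    induction m with
    | zero =>
      have : K.map (· ^ 0) = Matrix.vecMulVec (fun _ => 1) (star fun _ => (1 : ℝ)) := by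
        ext i j; simp [Matrix.vecMulVec_apply]
      rw [this]
      exact Matrix.posSemidef_vecMulVec_self_star _
    | succ m ih =>
      have : K.map (· ^ (m + 1)) = (K.map (· ^ m)) ⊙ K := by
        ext i j; simp [pow_succ]
      rw [this]
      exact ih.hadamard hK
  refine Matrix.PosSemidef.of_dotProduct_mulVec_nonneg ?_ fun x => ?_
  · ext i j
    have := hK.isHermitian.apply j i
    simp only [Matrix.conjTranspose_apply, Matrix.map_apply, star_trivial] at this ⊢
    rw [this]
  · have hlim : Tendsto (fun N : ℕ => ∑ m ∈ Finset.range N,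
        ((m.factorial : ℝ)⁻¹ * (star x ⬝ᵥ ((K.map (· ^ m)) *ᵥ x)))) atTop
        (𝓝 (star x ⬝ᵥ ((K.map Real.exp) *ᵥ x))) := by
      have h1 : ∀ N : ℕ, ∑ m ∈ Finset.range N,
          ((m.factorial : ℝ)⁻¹ * (star x ⬝ᵥ ((K.map (· ^ m)) *ᵥ x))) =
          ∑ i, star x i * ∑ j, (∑ m ∈ Finset.range N, K i j ^ m / m.factorial) * x j := by
        intro N
        simp only [dotProduct, Matrix.mulVec, Matrix.map_apply, Finset.mul_sum, Finset.sum_mul]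
        rw [Finset.sum_comm]
        refine Finset.sum_congr rfl fun i _ => ?_
        rw [Finset.sum_comm]
        refine Finset.sum_congr rfl fun j _ => Finset.sum_congr rfl fun m _ => ?_
        ring
      simp only [h1]
      refine tendsto_finsetSum _ fun i _ => tendsto_const_nhds.mul
        (tendsto_finsetSum _ fun j _ => Tendsto.mul_const _ ?_)
      have := (NormedSpace.expSeries_div_hasSum_exp (K i j)).tendsto_sum_nat
      rwa [← Real.exp_eq_exp_ℝ] at this
    refine ge_of_tendsto' hlim fun N => Finset.sum_nonneg fun m _ => mul_nonneg (by positivity) ?_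
    exact (hpow m).dotProduct_mulVec_nonneg x

open scoped Matrix in
/-- Schoenberg: if `k` is a real symmetric kernel on a finite set that vanishes on the diagonal
and is conditionally negative, then `exp (-τ k)` is positive semidefinite. -/
theorem sum_exp_neg_mul_nonneg {ι : Type*} [Fintype ι] (k : ι → ι → ℝ)
    (hsymm : ∀ i j, k i j = k j i)
    (hneg : ∀ z : ι → ℝ, ∑ i, z i = 0 → ∑ i, ∑ j, z i * z j * k i j ≤ 0)
    {τ : ℝ} (hτ : 0 ≤ τ) (z : ι → ℝ) :
    0 ≤ ∑ i, ∑ j, z i * z j * Real.exp (-τ * k i j) := by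
  classical
  rcases isEmpty_or_nonempty ι with h | ⟨⟨o⟩⟩
  · simp
  -- the Gram matrix of the kernel based at `o`
  let K : Matrix ι ι ℝ := .of fun i j => τ * (k i o + k o j - k i j - k o o)
  have hKapp : ∀ i j, K i j = τ * (k i o + k o j - k i j - k o o) := fun _ _ => rfl
  have hK : K.PosSemidef := by
    refine Matrix.PosSemidef.of_dotProduct_mulVec_nonneg ?_ fun x => ?_
    · ext i j
      simp only [Matrix.conjTranspose_apply, star_trivial, hKapp]
      rw [hsymm j o, hsymm o i, hsymm j i]; ring
    · have h0 := hneg (fun i => x i - if i = o then ∑ j, x j else 0)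
        (by simp [Finset.sum_sub_distrib])
      have h1 : star x ⬝ᵥ (K *ᵥ x) =
          -τ * ∑ i, ∑ j, (x i - if i = o then ∑ j, x j else 0) *
            (x j - if j = o then ∑ j, x j else 0) * k i j := by
        set s := ∑ j, x j with hs
        have e1 : ∑ i, ∑ j, (x i - if i = o then s else 0) * (x j - if j = o then s else 0) * k i j
            = ∑ i, ∑ j, x i * x j * k i j - s * ∑ i, x i * k i o - s * ∑ j, x j * k o j
              + s * s * k o o := by
          have : ∀ i j, (x i - if i = o then s else 0) * (x j - if j = o then s else 0) * k i j
              = x i * x j * k i j - (if j = o then s * (x i * k i j) else 0)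
                - (if i = o then s * (x j * k i j) else 0)
                + (if i = o then if j = o then s * s * k i j else 0 else 0) := by
            intro i j
            split_ifs <;> ring
          simp only [this, Finset.sum_add_distrib, Finset.sum_sub_distrib]
          simp [Finset.mul_sum, Finset.sum_ite_irrel]
        rw [e1]
        have e2 : star x ⬝ᵥ (K *ᵥ x) = τ * (∑ i, ∑ j, x i * x j * k i o
            + ∑ i, ∑ j, x i * x j * k o j - ∑ i, ∑ j, x i * x j * k i j
            - ∑ i, ∑ j, x i * x j * k o o) := by
          simp only [dotProduct, Matrix.mulVec, hKapp, Finset.mul_sum, ← Finset.sum_add_distrib,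
            ← Finset.sum_sub_distrib]
          refine Finset.sum_congr rfl fun i _ => Finset.sum_congr rfl fun j _ => ?_
          simp only [star_trivial]
          ring
        have e3 : ∑ i, ∑ j, x i * x j * k i o = s * ∑ i, x i * k i o := by
          rw [hs, Finset.sum_mul_sum, Finset.sum_comm]
          refine Finset.sum_congr rfl fun i _ => Finset.sum_congr rfl fun j _ => by ring
        have e4 : ∑ i, ∑ j, x i * x j * k o j = s * ∑ j, x j * k o j := by
          rw [hs, Finset.sum_mul_sum]
          refine Finset.sum_congr rfl fun i _ => Finset.sum_congr rfl fun j _ => by ring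
        have e5 : ∑ i, ∑ j, x i * x j * k o o = s * s * k o o := by
          rw [hs, Finset.sum_mul_sum, Finset.sum_mul]
          exact Finset.sum_congr rfl fun i _ => by rw [Finset.sum_mul]
        rw [e2, e3, e4, e5]; ring
      rw [h1]
      nlinarith
  have := hK.map_rexp.dotProduct_mulVec_nonneg
    (fun i => z i * Real.exp (-τ * (k i o - k o o / 2)))
  refine this.trans_eq ?_
  simp only [dotProduct, Matrix.mulVec, Finset.mul_sum]
  refine Finset.sum_congr rfl fun i _ => Finset.sum_congr rfl fun j _ => ?_
  have : Real.exp (-τ * k i j) = Real.exp (-τ * (k i o - k o o / 2)) *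
      (Real.exp (K i j) * Real.exp (-τ * (k j o - k o o / 2))) := by
    rw [← Real.exp_add, ← Real.exp_add]
    congr 1
    rw [hKapp, hsymm j o]; ring
  rw [this]
  simp only [star_trivial, Matrix.map_apply, Pi.star_apply]
  ring

/-! ### Combinatorics of bounded geometry coarse structures -/

namespace CoarseStructure

variable {X : Type u} {𝓔 : CoarseStructure X}

/-- Bounded geometry in terms of the cardinality of the rows and columns of a controlled set. -/
theorem BoundedGeometry.exists_bound (h : 𝓔.BoundedGeometry) {E : Set (X × X)}
    (hE : 𝓔.IsControlled E) :
    ∃ M : ℕ, ∀ x, ({y | (x, y) ∈ E}.Finite ∧ {y | (x, y) ∈ E}.ncard ≤ M) ∧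
      ({y | (y, x) ∈ E}.Finite ∧ {y | (y, x) ∈ E}.ncard ≤ M) := by
  obtain ⟨M, hM⟩ := h E hE
  have key : ∀ x, ∀ s ⊆ {y | (x, y) ∈ E ∪ relInv E}, s.Finite ∧ s.ncard ≤ M := by
    intro x s hs
    have h1 := (encard_le_encard hs).trans (hM x)
    have hfin := finite_of_encard_le_coe h1
    refine ⟨hfin, ?_⟩
    rw [← hfin.cast_ncard_eq] at h1
    exact_mod_cast h1
  exact ⟨M, fun x => ⟨key x _ fun y hy => Or.inl hy, key x _ fun y hy => Or.inr hy⟩⟩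

/-- Greedy colouring of the graph of a controlled set, which has bounded degree. -/
theorem BoundedGeometry.exists_coloring (h : 𝓔.BoundedGeometry) {G : Set (X × X)}
    (hG : 𝓔.IsControlled G) :
    ∃ (m : ℕ) (c : X → Fin m), ∀ x y, (x, y) ∈ G → x ≠ y → c x ≠ c y := by
  obtain ⟨M, hM⟩ := h.exists_bound (𝓔.union hG (𝓔.inv hG))
  set G' := G ∪ relInv G with hG'
  have wf : WellFounded (WellOrderingRel : X → X → Prop) := IsWellFounded.wf
  let step : ∀ x : X, (∀ y, WellOrderingRel y x → ℕ) → ℕ := fun x ih =>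
    sInf {n | ∀ y (hy : WellOrderingRel y x), (x, y) ∈ G' → ih y hy ≠ n}
  let c : X → ℕ := wf.fix step
  have hc : ∀ x, c x = sInf {n | ∀ y, WellOrderingRel y x → (x, y) ∈ G' → c y ≠ n} :=
    fun x => wf.fix_eq step x
  -- at most `M` colours are forbidden at `x`, so one of `0, …, M` is available
  have hne : ∀ x, ∃ n ≤ M, ∀ y, WellOrderingRel y x → (x, y) ∈ G' → c y ≠ n := by
    intro x
    by_contra! hcon
    have hsub : (Finset.range (M + 1) : Set ℕ) ⊆ c '' {y | (x, y) ∈ G'} := by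
      intro n hn
      obtain ⟨y, -, hy, hyn⟩ := hcon n (by simpa [Nat.lt_succ_iff] using hn)
      exact ⟨y, hy, hyn⟩
    have h1 := ncard_le_ncard hsub ((hM x).1.1.image c)
    rw [ncard_coe_finset, Finset.card_range] at h1
    have h2 := ncard_image_le (f := c) (hM x).1.1
    have h3 := (hM x).1.2
    omega
  have hle : ∀ x, c x < M + 1 := fun x => by
    obtain ⟨n, hn, hx⟩ := hne x
    rw [hc x]
    exact Nat.lt_succ_of_le (le_trans (Nat.sInf_le (show n ∈ {n | _} from hx)) hn)
  have hmem : ∀ x y, WellOrderingRel y x → (x, y) ∈ G' → c y ≠ c x := fun x y => by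
    obtain ⟨n, -, hx⟩ := hne x
    have := Nat.sInf_mem (s := {n | ∀ y, WellOrderingRel y x → (x, y) ∈ G' → c y ≠ n}) ⟨n, hx⟩
    rw [← hc x] at this
    exact this y
  refine ⟨M + 1, fun x => ⟨c x, hle x⟩, fun x y hxy hne => ?_⟩
  rw [Ne, Fin.mk.injEq]
  rcases trichotomous_of WellOrderingRel x y with h1 | h1 | h1
  · exact hmem y x h1 (Or.inr hxy)
  · exact absurd h1 hne
  · exact (hmem x y h1 (Or.inl hxy)).symm

theorem isControlled_relPow {E : Set (X × X)} (hE : 𝓔.IsControlled E) (n : ℕ) :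
    𝓔.IsControlled (relPow E n) := by
  induction n with
  | zero => exact 𝓔.diag
  | succ n ih => exact 𝓔.comp ih hE

namespace SplitsIntoFiniteComponents

variable {Y : ℕ → Set X}

theorem mem_iff (hY : 𝓔.SplitsIntoFiniteComponents Y) {n : ℕ} {x y : X} (hx : x ∈ Y n) :
    y ∈ Y n ↔ 𝓔.IsControlled {(x, y)} := by
  obtain ⟨o, ho⟩ := hY.isComponent n
  rw [ho] at hx ⊢
  change 𝓔.IsControlled {(o, x)} at hx
  change 𝓔.IsControlled {(o, y)} ↔ _
  constructor
  · intro h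
    refine 𝓔.subset (𝓔.comp (𝓔.inv hx) h) ?_
    rintro _ rfl
    exact ⟨o, rfl, rfl⟩
  · intro h
    refine 𝓔.subset (𝓔.comp hx h) ?_
    rintro _ rfl
    exact ⟨x, rfl, rfl⟩

theorem mem_of_mem_controlled (hY : 𝓔.SplitsIntoFiniteComponents Y) {E : Set (X × X)}
    (hE : 𝓔.IsControlled E) {n : ℕ} {x y : X} (hx : x ∈ Y n) (hxy : (x, y) ∈ E) : y ∈ Y n :=
  (hY.mem_iff hx).2 (𝓔.subset hE (singleton_subset_iff.2 hxy))

/-- Only finitely many components meet a given finite set. -/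
theorem eventually_notMem (hY : 𝓔.SplitsIntoFiniteComponents Y) {s : Set X}
    (hs : s.Finite) : ∀ᶠ n in atTop, ∀ x ∈ Y n, x ∉ s := by
  have hx : ∀ x ∈ s, ∀ᶠ n in atTop, x ∉ Y n := by
    intro x _
    obtain ⟨m, hm⟩ := mem_iUnion.1 (hY.cover.symm ▸ mem_univ x)
    filter_upwards [eventually_gt_atTop m] with n hn hxn
    exact (hY.disjoint hn.ne').ne_of_mem hxn hm rfl
  filter_upwards [(hs.eventually_all).2 hx] with n hn x hxn hxs
  exact hn x hxs hxn

/-- Components are connected for a generating set, so that a ball of radius `K` has at least `K`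
elements as soon as its component has. -/
theorem exists_large_slices (hY : 𝓔.SplitsIntoFiniteComponents Y) (hb : 𝓔.BoundedGeometry)
    (hm : ∃ E, 𝓔.IsGenerating E) (K : ℕ) :
    ∃ F, 𝓔.IsControlled F ∧
      ∀ n, K ≤ (Y n).ncard → ∀ x ∈ Y n, K ≤ {y | (x, y) ∈ F}.ncard := by
  obtain ⟨E, hE, hgen⟩ := hm
  set S : Set (X × X) := E ∪ {p | p.1 = p.2} with hS
  have hSc : 𝓔.IsControlled S := 𝓔.union hE 𝓔.diag
  have hmono : ∀ (x : X) j, {y | (x, y) ∈ relPow S j} ⊆ {y | (x, y) ∈ relPow S (j + 1)} :=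
    fun x j y hy => ⟨y, hy, Or.inr rfl⟩
  have hfin : ∀ (x : X) j, {y | (x, y) ∈ relPow S j}.Finite := fun x j => by
    obtain ⟨M, hM⟩ := hb.exists_bound (isControlled_relPow hSc j)
    exact (hM x).1.1
  -- a ball that stops growing is the whole component
  have hstab : ∀ n, ∀ x ∈ Y n, ∀ j,
      {y | (x, y) ∈ relPow S (j + 1)} ⊆ {y | (x, y) ∈ relPow S j} →
      Y n ⊆ {y | (x, y) ∈ relPow S j} := by
    intro n x hx j hj
    have hpow : ∀ i, ∀ y, (x, y) ∈ relPow E i → (x, y) ∈ relPow S j := by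
      intro i
      induction i with
      | zero =>
        rintro y (rfl : x = y)
        clear hj
        induction j with
        | zero => rfl
        | succ j ih => exact hmono _ _ ih
      | succ i ih =>
        rintro y ⟨z, hz, hzy⟩
        exact hj ⟨z, ih z hz, Or.inl hzy⟩
    intro y hy
    obtain ⟨i, -, hi⟩ := hgen _ ((hY.mem_iff hx).1 hy)
    exact hpow i y (hi rfl)
  have hgrow : ∀ n, ∀ x ∈ Y n, ∀ j, j + 1 ≤ {y | (x, y) ∈ relPow S j}.ncard ∨
      Y n ⊆ {y | (x, y) ∈ relPow S j} := by
    intro n x hx j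
    induction j with
    | zero =>
      left
      have : {y | (x, y) ∈ relPow S 0} = {x} := by
        ext y; exact eq_comm
      rw [this, ncard_singleton]
    | succ j ih =>
      by_cases hj : {y | (x, y) ∈ relPow S (j + 1)} ⊆ {y | (x, y) ∈ relPow S j}
      · exact Or.inr ((hstab n x hx j hj).trans (hmono x j))
      · rcases ih with ih | ih
        · left
          have := ncard_lt_ncard ((hmono x j).ssubset_of_not_subset hj) (hfin x (j + 1))
          omega
        · exact Or.inr (ih.trans (hmono x j))
  refine ⟨relPow S K, isControlled_relPow hSc K, fun n hn x hx => ?_⟩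
  rcases hgrow n x hx K with h | h
  · omega
  · exact hn.trans (ncard_le_ncard h (hfin x K))

end SplitsIntoFiniteComponents

end CoarseStructure

/-- The partial involution whose graph is a given symmetric functional relation. -/
theorem exists_pequiv_of_symm_of_functional {X : Type u} {m : Set (X × X)}
    (hs : ∀ x y, (x, y) ∈ m → (y, x) ∈ m)
    (hf : ∀ x y z, (x, y) ∈ m → (x, z) ∈ m → y = z) :
    ∃ f : X ≃. X, ∀ x y, f y = some x ↔ (x, y) ∈ m := by
  classical
  let g : X → Option X := fun y => if h : ∃ x, (y, x) ∈ m then some h.choose else none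
  have hg : ∀ x y, g y = some x ↔ (y, x) ∈ m := by
    intro x y
    by_cases h : ∃ x, (y, x) ∈ m
    · simp only [g, dif_pos h, Option.some.injEq]
      exact ⟨fun h' => h' ▸ h.choose_spec, fun h' => hf _ _ _ h.choose_spec h'⟩
    · simp only [g, dif_neg h, reduceCtorEq, false_iff]
      exact fun h' => h ⟨x, h'⟩
  refine ⟨⟨g, g, fun a b => ?_⟩, fun x y => ?_⟩
  · rw [hg, hg]
    exact ⟨hs _ _, hs _ _⟩
  · change g y = some x ↔ _
    rw [hg]
    exact ⟨hs _ _, hs _ _⟩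

namespace CoarseStructure

variable {X : Type u} {𝓔 : CoarseStructure X}

/-- A partial translation that moves at least half of almost every component off a given
controlled set. It is a maximal matching of pairs of points that lie in a common large slice but
not in the given set: the unmatched points in a large slice are then all related by the given set,
so that double counting shows them to be rare. -/
theorem SplitsIntoFiniteComponents.exists_far_partialTranslation {Y : ℕ → Set X}
    (hY : 𝓔.SplitsIntoFiniteComponents Y)
    (hb : 𝓔.BoundedGeometry) (hm : ∃ E, 𝓔.IsGenerating E) {E : Set (X × X)}
    (hE : 𝓔.IsControlled E) :
    ∃ t : PartialTranslation 𝓔, (∀ x y, t.toPEquiv y = some x → (x, y) ∉ E) ∧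
      ∀ᶠ n in atTop, (Y n).ncard ≤ 2 * {x ∈ Y n | ∃ y, t.toPEquiv y = some x}.ncard := by
  classical
  set E' : Set (X × X) := E ∪ relInv E ∪ {p | p.1 = p.2} with hE'
  have hE'c : 𝓔.IsControlled E' := 𝓔.union (𝓔.union hE (𝓔.inv hE)) 𝓔.diag
  have hE's : ∀ x y, (x, y) ∈ E' → (y, x) ∈ E' := by
    rintro x y ((h | h) | h)
    · exact Or.inl (Or.inr h)
    · exact Or.inl (Or.inl h)
    · exact Or.inr (Eq.symm h)
  obtain ⟨b, hbd⟩ := hb.exists_bound hE'c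
  obtain ⟨F, hF, hFK⟩ := hY.exists_large_slices hb hm (2 * (b + 1))
  set G : Set (X × X) := relComp F (relInv F) \ E' with hG
  have hGc : 𝓔.IsControlled G := 𝓔.subset (𝓔.comp hF (𝓔.inv hF)) sdiff_subset
  have hGs : ∀ x y, (x, y) ∈ G → (y, x) ∈ G := by
    rintro x y ⟨⟨z, h1, h2⟩, h3⟩
    exact ⟨⟨z, h2, h1⟩, fun h => h3 (hE's _ _ h)⟩
  obtain ⟨m, hmax⟩ := zorn_subset {m : Set (X × X) | m ⊆ G ∧ (∀ x y, (x, y) ∈ m → (y, x) ∈ m) ∧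
      ∀ x y z, (x, y) ∈ m → (x, z) ∈ m → y = z} (by
    intro c hc hchain
    refine ⟨⋃₀ c, ⟨sUnion_subset fun s hs => (hc hs).1, ?_, ?_⟩,
      fun s hs => subset_sUnion_of_mem hs⟩
    · rintro x y ⟨s, hs, h⟩
      exact ⟨s, hs, (hc hs).2.1 _ _ h⟩
    · rintro x y z ⟨s, hs, h⟩ ⟨s', hs', h'⟩
      rcases hchain.total hs hs' with hle | hle
      · exact (hc hs').2.2 _ _ _ (hle h) h'
      · exact (hc hs).2.2 _ _ _ h (hle h'))
  obtain ⟨⟨hmG, hms, hmf⟩, hmmax⟩ := hmax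
  obtain ⟨f, hf⟩ := exists_pequiv_of_symm_of_functional hms hmf
  -- by maximality, two unmatched points cannot be matched to each other
  have hmatch : ∀ x y, (∀ z, (x, z) ∉ m) → (∀ z, (y, z) ∉ m) → (x, y) ∉ G := by
    intro x y hx hy hxy
    have hsub : m ∪ {(x, y), (y, x)} ⊆ m := by
      refine hmmax ⟨?_, ?_, ?_⟩ subset_union_left
      · refine union_subset hmG ?_
        rintro _ (rfl | rfl)
        · exact hxy
        · exact hGs _ _ hxy
      · rintro u v (h | h)
        · exact Or.inl (hms _ _ h)
        · simp only [mem_insert_iff, mem_singleton_iff, Prod.mk.injEq] at h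
          right
          simp only [mem_insert_iff, mem_singleton_iff, Prod.mk.injEq]
          tauto
      · rintro u v w (h | h) (h' | h')
        · exact hmf _ _ _ h h'
        · simp only [mem_insert_iff, mem_singleton_iff, Prod.mk.injEq] at h'
          rcases h' with ⟨rfl, rfl⟩ | ⟨rfl, rfl⟩
          exacts [absurd h (hx _), absurd h (hy _)]
        · simp only [mem_insert_iff, mem_singleton_iff, Prod.mk.injEq] at h
          rcases h with ⟨rfl, rfl⟩ | ⟨rfl, rfl⟩
          exacts [absurd h' (hx _), absurd h' (hy _)]
        · simp only [mem_insert_iff, mem_singleton_iff, Prod.mk.injEq] at h h'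
          rcases h with ⟨h1, h2⟩ | ⟨h1, h2⟩ <;> rcases h' with ⟨h3, h4⟩ | ⟨h3, h4⟩
          · exact h2.trans h4.symm
          · exact h2.trans (h3.symm.trans (h1.trans h4.symm))
          · exact h2.trans (h3.symm.trans (h1.trans h4.symm))
          · exact h2.trans h4.symm
    exact hx y (hsub (Or.inr (Or.inl rfl)))
  refine ⟨⟨f, 𝓔.subset hGc fun p hp => hmG ((hf _ _).1 hp)⟩, fun x y hxy hxyE => ?_, ?_⟩
  · exact (hmG ((hf _ _).1 hxy)).2 (Or.inl (Or.inl hxyE))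
  filter_upwards [hY.card_tendsto.eventually_ge_atTop (2 * (b + 1))] with n hn
  simp only [hf]
  have hfinY := hY.finite n
  set s := hfinY.toFinset with hs
  have hcard : (Y n).ncard = s.card := ncard_eq_toFinset_card _ hfinY
  have hR : {x ∈ Y n | ∃ y, (x, y) ∈ m}.ncard = (s.filter fun x => ∃ y, (x, y) ∈ m).card := by
    rw [← ncard_coe_finset]
    congr 1
    ext x; simp [hs]
  -- count the pairs in `F` with unmatched first point
  have hdc : (s.filter fun x => ¬ ∃ y, (x, y) ∈ m).card * (2 * (b + 1)) ≤ s.card * (b + 1) := by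
    refine Finset.card_mul_le_card_mul (fun x z => (x, z) ∈ F) ?_ ?_
    · intro x hx
      have hxY : x ∈ Y n := by simpa [hs] using (Finset.mem_filter.1 hx).1
      refine (hFK n hn x hxY).trans ?_
      rw [← ncard_coe_finset]
      refine ncard_le_ncard (fun y hy => ?_) (Finset.finite_toSet _)
      simp only [Finset.mem_coe, Finset.mem_bipartiteAbove]
      exact ⟨by simpa [hs] using hY.mem_of_mem_controlled hF hxY hy, hy⟩
    · intro z _
      rcases (Finset.bipartiteBelow (fun x z => (x, z) ∈ F)
        (s.filter fun x => ¬ ∃ y, (x, y) ∈ m) z).eq_empty_or_nonempty with h0 | ⟨x, hx⟩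
      · rw [h0]; simp
      · refine le_trans ?_ ((hbd x).1.2.trans (Nat.le_succ b))
        rw [← ncard_coe_finset]
        refine ncard_le_ncard (fun y hy => ?_) (hbd x).1.1
        simp only [Finset.mem_coe, Finset.mem_bipartiteBelow, Finset.mem_filter, not_exists]
          at hx hy
        by_contra hcon
        exact hmatch x y hx.1.2 hy.1.2 ⟨⟨z, hx.2, hy.2⟩, hcon⟩
  have hsplit := Finset.card_filter_add_card_filter_not (s := s) (fun x => ∃ y, (x, y) ∈ m)
  rw [hcard, hR]
  have : (s.filter fun x => ¬ ∃ y, (x, y) ∈ m).card * 2 ≤ s.card := by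
    refine Nat.le_of_mul_le_mul_right ?_ (Nat.succ_pos b)
    calc _ = (s.filter fun x => ¬ ∃ y, (x, y) ∈ m).card * (2 * (b + 1)) := by
          rw [Nat.succ_eq_add_one]; ring
      _ ≤ _ := hdc
  omega

/-! ### Ultrafilters on controlled sets -/

theorem tendsto_pure_comp {I X : Type*} (q : Ultrafilter I) (f : I → X) :
    Tendsto (fun i => (pure (f i) : Ultrafilter X)) q (𝓝 (q.map f)) :=
  (Ultrafilter.tendsto_pure_self (q.map f)).comp (g := pure) tendsto_map

theorem tendsto_pure_prod {I X : Type*} (q : Ultrafilter I) (f g : I → X) :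
    Tendsto (fun i => ((pure (f i), pure (g i)) : Ultrafilter X × Ultrafilter X)) q
      (𝓝 (q.map f, q.map g)) :=
  (tendsto_pure_comp q f).prodMk_nhds (tendsto_pure_comp q g)

theorem mem_betaClosure_of_eventually {I : Type*} {X : Type u} {q : Ultrafilter I} {f g : I → X}
    {E : Set (X × X)} (h : ∀ᶠ i in q, (f i, g i) ∈ E) : (q.map f, q.map g) ∈ betaClosure E :=
  mem_closure_of_tendsto (tendsto_pure_prod q f g) (h.mono fun i hi => ⟨(f i, g i), hi, rfl⟩)

/-- Closures in `βX × βX` of disjoint controlled sets are disjoint; here for the graph of a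
partial translation. A finite colouring provides a set `B` of the second ultrafilter for which
`t B × B` misses the other controlled set. -/
theorem BoundedGeometry.notMem_betaClosure (hb : 𝓔.BoundedGeometry) (t : PartialTranslation 𝓔)
    {E : Set (X × X)} (hE : 𝓔.IsControlled E)
    (hdisj : ∀ x y, t.toPEquiv y = some x → (x, y) ∉ E) {I : Type*} {q : Ultrafilter I}
    {f g : I → X} (hq : ∀ᶠ j in q, t.toPEquiv (g j) = some (f j)) :
    (q.map f, q.map g) ∉ betaClosure E := by
  obtain ⟨m, c, hc⟩ := hb.exists_coloring (𝓔.comp (𝓔.inv t.controlled) hE)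
  obtain ⟨i, hi⟩ : ∃ i, ∀ᶠ j in q, c (g j) = i := by
    have h1 : ∀ᶠ j in (q : Filter I), ∃ i, c (g j) = i := Eventually.of_forall fun j => ⟨_, rfl⟩
    exact Ultrafilter.eventually_exists_iff.1 h1
  set A : Set X := {x | ∃ y, t.toPEquiv y = some x ∧ c y = i} with hA
  set B : Set X := {y | c y = i} with hB
  intro hcl
  have hopen : IsOpen ({u : Ultrafilter X | A ∈ u} ×ˢ {u : Ultrafilter X | B ∈ u}) :=
    (ultrafilter_isOpen_basic A).prod (ultrafilter_isOpen_basic B)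
  obtain ⟨_, ⟨hxA, hyB⟩, ⟨⟨x, y⟩, hxy, rfl⟩⟩ := mem_closure_iff.1 hcl _ hopen
    ⟨by filter_upwards [hq, hi] with j h1 h2 using ⟨g j, h1, h2⟩, hi⟩
  obtain ⟨y', hy', hcy'⟩ : x ∈ A := Ultrafilter.mem_pure.1 hxA
  have hcy : c y = i := Ultrafilter.mem_pure.1 hyB
  by_cases hyy : y' = y
  · subst hyy
    exact hdisj x y' hy' hxy
  · exact hc y' y ⟨x, hy', hxy⟩ hyy (hcy'.trans hcy.symm)

/-- A map at controlled distance from the identity is finite-to-one, so that it preserves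
non-principality of ultrafilters. -/
theorem BoundedGeometry.map_mem_corona (hb : 𝓔.BoundedGeometry) {E : Set (X × X)}
    (hE : 𝓔.IsControlled E) {q : Ultrafilter X} (hq : (q : Filter X) ≤ cofinite) {f : X → X}
    (hf : ∀ x, (x, f x) ∈ E) : q.map f ∈ corona X := by
  rintro ⟨x, hx⟩
  obtain ⟨M, hM⟩ := hb.exists_bound hE
  have h1 : f ⁻¹' {x} ∈ q := by
    rw [← Ultrafilter.mem_map, ← hx]
    exact Ultrafilter.mem_pure.2 rfl
  have h2 : (f ⁻¹' {x}).Finite := (hM x).2.1.subset fun y (hy : f y = x) => hy ▸ hf y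
  exact Ultrafilter.compl_notMem_iff.2 h1 (hq h2.compl_mem_cofinite)

end CoarseStructure

/-! ### Spreading a boundary kernel over the space -/

theorem isClosed_corona (X : Type u) : IsClosed (corona X) := by
  rw [corona, isClosed_compl_iff]
  have : Set.range (pure : X → Ultrafilter X) = ⋃ x, {u : Ultrafilter X | {x} ∈ u} := by
    ext u
    simp only [mem_range, mem_iUnion, mem_ofPred_eq]
    refine exists_congr fun x => ⟨?_, fun h => ?_⟩
    · rintro rfl
      exact Ultrafilter.mem_pure.2 rfl
    · refine (Ultrafilter.eq_of_le ?_).symm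
      rw [Ultrafilter.coe_pure]
      exact le_pure_iff.2 h
  rw [this]
  exact isOpen_iUnion fun x => ultrafilter_isOpen_basic _

theorem isClosed_boundaryClosure {X : Type u} (E : Set (X × X)) : IsClosed (boundaryClosure E) :=
  isClosed_closure.inter ((isClosed_corona X).prod (isClosed_corona X))

namespace CoarseStructure

variable {X : Type u} {𝓔 : CoarseStructure X}

/-- The inclusion of `∂E` in `∂_𝓔 X`. -/
def boundaryIncl {E : Set (X × X)} (hE : 𝓔.IsControlled E) (p : boundaryClosure E) :
    𝓔.Boundary :=
  ⟨p.1.1, p.1.2, E, hE, p.2⟩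

theorem continuous_boundaryIncl {E : Set (X × X)} (hE : 𝓔.IsControlled E) :
    Continuous (boundaryIncl hE) := by
  rw [continuous_induced_rng]
  have h1 : Continuous (𝓔.betaIncl ⟨E, hE⟩) :=
    continuous_iSup_rng (i := (⟨E, hE⟩ : 𝓔.Controlled)) continuous_coinduced_rng
  have h2 : Continuous fun p : boundaryClosure E => (⟨p.1, p.2.1⟩ : betaClosure E) := by
    fun_prop
  exact h1.comp h2

/-- Tietze: a continuous function on `∂_𝓔 X` is, on each `∂E`, the restriction of a continuous
function on `βX × βX`. -/
theorem exists_tietze {k : 𝓔.Boundary → ℝ≥0} (hk : Continuous k) {E : Set (X × X)}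
    (hE : 𝓔.IsControlled E) :
    ∃ h : C(Ultrafilter X × Ultrafilter X, ℝ≥0), ∀ p : 𝓔.Boundary,
      (p.fst, p.snd) ∈ boundaryClosure E → h (p.fst, p.snd) = k p := by
  obtain ⟨h, hh⟩ := ContinuousMap.exists_restrict_eq (isClosed_boundaryClosure E)
    ⟨k ∘ boundaryIncl hE, hk.comp (continuous_boundaryIncl hE)⟩
  exact ⟨h, fun p hp => DFunLike.congr_fun hh ⟨_, hp⟩⟩

/-- A function on `X × X` whose limits along non-principal ultrafilters on controlled sets are
the values of `k`. It is pasted from Tietze extensions over the pieces of `X × X` on which the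
word length for a generating set is constant; a controlled set meets finitely many of these. -/
theorem exists_extension_of_boundary {k : 𝓔.Boundary → ℝ≥0} (hk : Continuous k)
    (hm : ∃ E, 𝓔.IsGenerating E) :
    ∃ κ : X → X → ℝ, (∀ x y, 0 ≤ κ x y) ∧
      (∀ F, 𝓔.IsControlled F → ∃ C, ∀ x y, (x, y) ∈ F → κ x y ≤ C) ∧
      ∀ (q : Ultrafilter X) (f g : X → X) (F : Set (X × X)), 𝓔.IsControlled F →
        (∀ᶠ i in q, (f i, g i) ∈ F) → ∀ p : 𝓔.Boundary, p.fst = q.map f → p.snd = q.map g →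
        Tendsto (fun i => κ (f i) (g i)) q (𝓝 (k p)) := by
  obtain ⟨E, hE, hgen⟩ := hm
  let D : ℕ → Set (X × X) := fun n => {p | p ∈ relPow E n ∧ sInf {m | p ∈ relPow E m} = n}
  have hD : ∀ n, 𝓔.IsControlled (D n) := fun n =>
    𝓔.subset (isControlled_relPow hE n) fun p hp => hp.1
  choose h hh using fun n => exists_tietze hk (hD n)
  have hlevel : ∀ F, 𝓔.IsControlled F → ∃ n, ∀ p ∈ F, ∃ l : Fin (n + 1),
      p ∈ D l ∧ sInf {m | p ∈ relPow E m} = l := by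
    intro F hF
    obtain ⟨n, -, hn⟩ := hgen F hF
    refine ⟨n, fun p hp => ⟨⟨sInf {m | p ∈ relPow E m}, ?_⟩, ⟨?_, rfl⟩, rfl⟩⟩
    · exact Nat.lt_succ_of_le (Nat.sInf_le (show n ∈ {m | p ∈ relPow E m} from hn hp))
    · exact Nat.sInf_mem (s := {m | p ∈ relPow E m}) ⟨n, hn hp⟩
  refine ⟨fun x y => h (sInf {m | (x, y) ∈ relPow E m}) (pure x, pure y),
    fun x y => NNReal.coe_nonneg _, fun F hF => ?_, fun q f g F hF hfg p hp1 hp2 => ?_⟩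
  · obtain ⟨n, hn⟩ := hlevel F hF
    have hbdd : ∀ l, ∃ B : ℝ≥0, ∀ w, h l w ≤ B := fun l => by
      obtain ⟨B, hB⟩ := (isCompact_range (h l).continuous).bddAbove
      exact ⟨B, fun w => hB ⟨w, rfl⟩⟩
    choose B hB using hbdd
    refine ⟨((∑ l : Fin (n + 1), B l : ℝ≥0) : ℝ), fun x y hxy => NNReal.coe_le_coe.2 ?_⟩
    obtain ⟨l, -, hl⟩ := hn _ hxy
    rw [hl]
    exact (hB l _).trans (Finset.single_le_sum (f := fun l : Fin (n + 1) => B l)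
      (fun _ _ => zero_le) (Finset.mem_univ l))
  · obtain ⟨n, hn⟩ := hlevel F hF
    obtain ⟨l, hl⟩ := Ultrafilter.eventually_exists_iff.1 (hfg.mono fun i hi => hn _ hi)
    have hpD : (p.fst, p.snd) ∈ boundaryClosure (D l) := by
      obtain ⟨-, -, -, hc⟩ := p.mem
      refine ⟨?_, hc⟩
      rw [hp1, hp2]
      exact mem_betaClosure_of_eventually (hl.mono fun i hi => hi.1)
    rw [← hh l p hpD, hp1, hp2]
    have h1 := ((h l).continuous.tendsto (q.map f, q.map g)).comp (tendsto_pure_prod q f g)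
    refine ((NNReal.continuous_coe.tendsto _).comp h1).congr' ?_
    filter_upwards [hl] with i hi
    simp only [Function.comp_apply]
    rw [hi.2]

/-- The data extracted from a kernel on the boundary: a symmetric function on `X × X`, zero on the
diagonal, bounded on controlled sets, and with the values of the kernel as limits along
non-principal ultrafilters. -/
structure IsExtensionOf (κ : X → X → ℝ) (k : 𝓔.Boundary → ℝ≥0) : Prop where
  nonneg : ∀ x y, 0 ≤ κ x y
  symm : ∀ x y, κ x y = κ y x
  diag : ∀ x, κ x x = 0
  bounded : ∀ F, 𝓔.IsControlled F → ∃ C, ∀ x y, (x, y) ∈ F → κ x y ≤ C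
  tendsto : ∀ (q : Ultrafilter X) (f g : X → X) (F : Set (X × X)), 𝓔.IsControlled F →
    (∀ᶠ i in q, (f i, g i) ∈ F) → ∀ p : 𝓔.Boundary, p.fst = q.map f → p.snd = q.map g →
    Tendsto (fun i => κ (f i) (g i)) q (𝓝 (k p))

theorem IsProperNegativeTypeKernel.exists_isExtensionOf {k : 𝓔.Boundary → ℝ≥0}
    (hk : 𝓔.IsProperNegativeTypeKernel k) (hm : ∃ E, 𝓔.IsGenerating E) :
    ∃ κ, IsExtensionOf κ k := by
  classical
  obtain ⟨κ, h0, hb, hl⟩ := exists_extension_of_boundary hk.continuous hm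
  refine ⟨fun x y => if x = y then 0 else (κ x y + κ y x) / 2, ⟨fun x y => ?_, fun x y => ?_,
    fun x => if_pos rfl, fun F hF => ?_, fun q f g F hF hfg p hp1 hp2 => ?_⟩⟩
  · have := h0 x y
    have := h0 y x
    split_ifs <;> positivity
  · rw [add_comm, if_congr eq_comm rfl rfl]
  · obtain ⟨C, hC⟩ := hb _ (𝓔.union hF (𝓔.inv hF))
    refine ⟨max 0 C, fun x y hxy => ?_⟩
    split_ifs
    · exact le_max_left _ _
    · have h1 := hC x y (Or.inl hxy)
      have h2 := hC y x (Or.inr hxy)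
      exact le_max_of_le_right (by linarith)
  · rcases q.em fun i => f i = g i with he | he
    · have hpp : p.fst = p.snd := by
        rw [hp1, hp2]
        exact Ultrafilter.coe_injective (Filter.map_congr he)
      rw [hk.normalized p hpp, NNReal.coe_zero]
      exact tendsto_const_nhds.congr' (he.mono fun i hi => (if_pos hi).symm)
    · have h1 := hl q f g F hF hfg p hp1 hp2
      have h2 := hl q g f _ (𝓔.inv hF) hfg (Boundary.flip 𝓔 p) hp2 hp1
      rw [hk.symmetric p] at h2
      have h3 := (h1.add h2).div_const 2
      rw [add_self_div_two] at h3
      exact h3.congr' (he.mono fun i hi => (if_neg hi).symm)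

end CoarseStructure

/-! ### Row sums and averages of matrices in the translation algebra -/

namespace TranslationAlgebra

variable {X : Type u} {𝓔 : CoarseStructure X}

noncomputable section

/-- The supremum of the `ℓ¹`-norms of the rows of a matrix, as the least upper bound for all
finite partial row sums. -/
def rowNorm (T : TranslationAlgebra 𝓔) : ℝ :=
  sInf {C | 0 ≤ C ∧ ∀ x (s : Finset X), ∑ y ∈ s, ‖T.entry x y‖ ≤ C}

theorem rowNorm_le {T : TranslationAlgebra 𝓔} {C : ℝ} (hC : 0 ≤ C)
    (h : ∀ x (s : Finset X), ∑ y ∈ s, ‖T.entry x y‖ ≤ C) : T.rowNorm ≤ C :=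
  csInf_le ⟨0, fun _ h => h.1⟩ ⟨hC, h⟩

/-- The average over a finite set of the row sums of the Schur product of a matrix with `w`. -/
def schurAverage (w : X → X → ℝ) (s : Finset X) (T : TranslationAlgebra 𝓔) : ℂ :=
  (s.card : ℂ)⁻¹ * ∑ x ∈ s, ∑ y ∈ s, T.entry x y * w x y

/-- The value at the `z`-th row of a matrix of the Hermitian form with kernel `w`. -/
def rowForm (w : X → X → ℝ) (s : Finset X) (T : TranslationAlgebra 𝓔) (z : X) : ℂ :=
  ∑ x ∈ s, ∑ y ∈ s, star (T.entry z x) * T.entry z y * w x y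

variable {w : X → X → ℝ}

theorem schurAverage_star (hw : ∀ x y, w x y = w y x) (s : Finset X)
    (T : TranslationAlgebra 𝓔) : schurAverage w s (star T) = star (schurAverage w s T) := by
  rw [schurAverage, schurAverage, Finset.sum_comm]
  simp only [star_mul', star_sum, star_inv₀, star_natCast, star_entry]
  congr 1
  refine Finset.sum_congr rfl fun x _ => Finset.sum_congr rfl fun y _ => ?_
  rw [hw y x]
  simp

variable [h𝓔 : 𝓔.IsSpace]

theorem rowNorm_bounds (T : TranslationAlgebra 𝓔) :
    0 ≤ T.rowNorm ∧ ∀ x (s : Finset X), ∑ y ∈ s, ‖T.entry x y‖ ≤ T.rowNorm := by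
  classical
  have hne : {C | 0 ≤ C ∧ ∀ x (s : Finset X), ∑ y ∈ s, ‖T.entry x y‖ ≤ C}.Nonempty := by
    obtain ⟨C, hC⟩ := T.bounded
    obtain ⟨M, hM⟩ := T.exists_row_bound
    refine ⟨M * |C|, by positivity, fun x s => ?_⟩
    obtain ⟨r, hr, hrs⟩ := hM x
    calc ∑ y ∈ s, ‖T.entry x y‖ ≤ ∑ y ∈ s ∩ r, ‖T.entry x y‖ := by
          refine (Finset.sum_subset Finset.inter_subset_left fun y hy hyr => ?_).ge
          rw [norm_eq_zero]
          by_contra hcon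
          exact hyr (Finset.mem_inter.2 ⟨hy, hrs y hcon⟩)
      _ ≤ (s ∩ r).card • |C| :=
          Finset.sum_le_card_nsmul _ _ _ fun y _ => (hC x y).trans (le_abs_self C)
      _ ≤ M * |C| := by
          rw [nsmul_eq_mul]
          exact mul_le_mul_of_nonneg_right
            (by exact_mod_cast (Finset.card_le_card Finset.inter_subset_right).trans hr)
            (abs_nonneg C)
  exact ⟨le_csInf hne fun C hC => hC.1, fun x s => le_csInf hne fun C hC => hC.2 x s⟩

theorem rowNorm_mul_le (S T : TranslationAlgebra 𝓔) :
    (S * T).rowNorm ≤ S.rowNorm * T.rowNorm := by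
  refine rowNorm_le (mul_nonneg S.rowNorm_bounds.1 T.rowNorm_bounds.1) fun x s => ?_
  obtain ⟨r, hr⟩ := S.exists_row_finset x
  calc ∑ z ∈ s, ‖(S * T).entry x z‖
      ≤ ∑ z ∈ s, ∑ y ∈ r, ‖S.entry x y‖ * ‖T.entry y z‖ := by
        refine Finset.sum_le_sum fun z _ => ?_
        rw [mul_entry_eq_sum T hr]
        exact (norm_sum_le _ _).trans_eq (Finset.sum_congr rfl fun y _ => norm_mul _ _)
    _ = ∑ y ∈ r, ‖S.entry x y‖ * ∑ z ∈ s, ‖T.entry y z‖ := by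
        rw [Finset.sum_comm]
        exact Finset.sum_congr rfl fun y _ => (Finset.mul_sum _ _ _).symm
    _ ≤ ∑ y ∈ r, ‖S.entry x y‖ * T.rowNorm :=
        Finset.sum_le_sum fun y _ =>
          mul_le_mul_of_nonneg_left (T.rowNorm_bounds.2 y s) (norm_nonneg _)
    _ ≤ S.rowNorm * T.rowNorm := by
        rw [← Finset.sum_mul]
        exact mul_le_mul_of_nonneg_right (S.rowNorm_bounds.2 x r) T.rowNorm_bounds.1

/-- The rows of a matrix, listed by boundedly many functions on the space; short rows are filled
up with zero coefficients. -/
theorem exists_row_enumeration (T : TranslationAlgebra 𝓔) :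
    ∃ (M : ℕ) (a : Fin M → X → ℂ) (y : Fin M → X → X) (F : Set (X × X)) (C : ℝ),
      𝓔.IsControlled F ∧ (∀ i z, (z, y i z) ∈ F) ∧ (∀ i z, ‖a i z‖ ≤ C) ∧
      ∀ z (s : Finset X), (∀ x, x ∉ s → T.entry z x = 0) → ∀ g : X → ℂ,
        ∑ x ∈ s, T.entry z x * g x = ∑ i, a i z * g (y i z) := by
  classical
  obtain ⟨M, hM⟩ := T.exists_row_bound
  obtain ⟨C, hC⟩ := T.bounded
  choose r hr hrs using hM
  let r' : X → Finset X := fun z => (r z).filter fun x => T.entry z x ≠ 0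
  have he : ∀ z, Nonempty (r' z ↪ Fin M) := fun z =>
    Function.Embedding.nonempty_of_card_le (by
      rw [Fintype.card_coe, Fintype.card_fin]
      exact (Finset.card_filter_le _ _).trans (hr z))
  let e : ∀ z, r' z ↪ Fin M := fun z => (he z).some
  refine ⟨M, fun i z => Function.extend (e z) (fun x => T.entry z x) 0 i,
    fun i z => Function.extend (e z) (fun x => (x : X)) (fun _ => z) i,
    T.supp ∪ {p | p.1 = p.2}, |C|, 𝓔.union T.controlled 𝓔.diag, fun i z => ?_, fun i z => ?_,
    fun z s hs g => ?_⟩ <;> beta_reduce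
  · by_cases h : ∃ x, e z x = i
    · obtain ⟨x, rfl⟩ := h
      rw [(e z).injective.extend_apply]
      exact Or.inl (Finset.mem_filter.1 x.2).2
    · rw [Function.extend_apply' _ _ _ h]
      exact Or.inr rfl
  · by_cases h : ∃ x, e z x = i
    · obtain ⟨x, rfl⟩ := h
      rw [(e z).injective.extend_apply]
      exact (hC _ _).trans (le_abs_self C)
    · rw [Function.extend_apply' _ _ _ h]
      simp
  · have h1 : ∑ x ∈ s, T.entry z x * g x = ∑ x ∈ r' z, T.entry z x * g x := by
      refine (Finset.sum_subset (fun x hx => ?_) fun x _ hx => ?_).symm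
      · by_contra hxs
        exact (Finset.mem_filter.1 hx).2 (hs x hxs)
      · by_cases h0 : T.entry z x = 0
        · rw [h0, zero_mul]
        · exact absurd (Finset.mem_filter.2 ⟨hrs z x h0, h0⟩) hx
    rw [h1, ← Finset.sum_coe_sort]
    refine Finset.sum_of_injOn (e z) (e z).injective.injOn 
      (fun _ _ => Finset.mem_coe.2 (Finset.mem_univ _)) (fun i _ hi => ?_) fun x _ => ?_
    · have hi' : ¬ ∃ x, e z x = i := fun ⟨x, hx⟩ =>
        hi ⟨x, Finset.mem_coe.2 (Finset.mem_univ _), hx⟩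
      rw [Function.extend_apply' _ _ _ hi']
      simp
    · rw [(e z).injective.extend_apply, (e z).injective.extend_apply]

theorem norm_schurAverage_le (hw : ∀ x y, |w x y| ≤ 1) (s : Finset X)
    (T : TranslationAlgebra 𝓔) : ‖schurAverage w s T‖ ≤ T.rowNorm := by
  have h1 : ‖∑ x ∈ s, ∑ y ∈ s, T.entry x y * w x y‖ ≤ s.card * T.rowNorm := by
    rw [← nsmul_eq_mul]
    refine (norm_sum_le _ _).trans (Finset.sum_le_card_nsmul _ _ _ fun x _ => ?_)
    refine (norm_sum_le _ _).trans ((Finset.sum_le_sum fun y _ => ?_).trans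
      (T.rowNorm_bounds.2 x s))
    rw [norm_mul, Complex.norm_real]
    exact mul_le_of_le_one_right (norm_nonneg _) (hw x y)
  rw [schurAverage, norm_mul, norm_inv, Complex.norm_natCast]
  rcases Nat.eq_zero_or_pos s.card with h0 | h0
  · simpa [h0] using T.rowNorm_bounds.1
  · rw [inv_mul_le_iff₀ (by exact_mod_cast h0)]
    exact h1

/-- On a union of components, the average at `star T * T` is the average of the values of the
form with kernel `w` at the rows of `T`: exchanging the two summations expresses that the counting
measure is invariant. -/
theorem schurAverage_star_mul_self (s : Finset X) (T : TranslationAlgebra 𝓔)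
    (hs : ∀ x ∈ s, ∀ z, z ∉ s → T.entry z x = 0) :
    schurAverage w s (star T * T) = (s.card : ℂ)⁻¹ * ∑ z ∈ s, rowForm w s T z := by
  rw [schurAverage]
  congr 1
  have h1 : ∀ x ∈ s, ∀ y ∈ s, (star T * T).entry x y * w x y =
      ∑ z ∈ s, star (T.entry z x) * T.entry z y * w x y := by
    intro x hx y _
    rw [mul_entry_eq_sum (S := star T) T (s := s)
      (fun z hz => by rw [star_entry, hs x hx z hz, star_zero]), Finset.sum_mul]
    rfl
  rw [Finset.sum_congr rfl fun x hx => Finset.sum_congr rfl (h1 x hx)]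
  simp only [rowForm]
  conv_rhs => rw [Finset.sum_comm]
  exact Finset.sum_congr rfl fun x _ => Finset.sum_comm

end

end TranslationAlgebra

/-! ### Positivity at infinity -/

namespace CoarseStructure

variable {X : Type u} {𝓔 : CoarseStructure X}

/-- Schoenberg's theorem for the kernel on the corona; complex coefficients are treated by their
real and imaginary parts. -/
theorem IsProperNegativeTypeKernel.re_sum_exp_nonneg {k : 𝓔.Boundary → ℝ≥0}
    (hk : 𝓔.IsProperNegativeTypeKernel k) {n : ℕ} (ω : Fin n → Ultrafilter X)
    (h : ∀ i j, ∃ E, 𝓔.IsControlled E ∧ (ω i, ω j) ∈ boundaryClosure E) {τ : ℝ} (hτ : 0 ≤ τ)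
    (c : Fin n → ℂ) :
    0 ≤ (∑ i, ∑ j, star (c i) * c j *
      (Real.exp (-τ * (k ⟨ω i, ω j, h i j⟩ : ℝ)) : ℂ)).re := by
  have key := sum_exp_neg_mul_nonneg (fun i j => (k ⟨ω i, ω j, h i j⟩ : ℝ))
    (fun i j => by rw [← hk.symmetric ⟨ω i, ω j, h i j⟩]; rfl)
    (fun z hz => by
      have := hk.negativeType n ω h (fun i => (z i : ℂ)) (by exact_mod_cast hz)
      simp only [Complex.re_sum] at this
      refine le_trans (le_of_eq ?_) this
      refine Finset.sum_congr rfl fun i _ => Finset.sum_congr rfl fun j _ => ?_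
      simp [Complex.mul_re]) hτ
  have := add_nonneg (key fun i => (c i).re) (key fun i => (c i).im)
  refine this.trans_eq ?_
  simp only [Complex.re_sum, ← Finset.sum_add_distrib]
  refine Finset.sum_congr rfl fun i _ => Finset.sum_congr rfl fun j _ => ?_
  rw [Complex.re_mul_ofReal, Complex.mul_re, Complex.star_def, Complex.conj_re, Complex.conj_im]
  ring

variable [h𝓔 : 𝓔.IsSpace]

open TranslationAlgebra in
/-- For a fixed matrix, the form with kernel `exp (-τ κ)` is nearly nonnegative at all but
finitely many rows: along a non-principal ultrafilter of exceptional rows, the forms converge to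
a form with kernel `exp (-τ k)` on finitely many points of the corona, which is nonnegative by
Schoenberg's theorem. -/
theorem IsProperNegativeTypeKernel.finite_rowForm_lt {k : 𝓔.Boundary → ℝ≥0}
    (hk : 𝓔.IsProperNegativeTypeKernel k) {κ : X → X → ℝ} (hκ : IsExtensionOf κ k) {τ : ℝ}
    (hτ : 0 ≤ τ) (T : TranslationAlgebra 𝓔) {ε : ℝ} (hε : 0 < ε) :
    ∃ B : Set X, B.Finite ∧ ∀ z, z ∉ B → ∀ s : Finset X, (∀ x, x ∉ s → T.entry z x = 0) →
      -ε ≤ (rowForm (fun x y => Real.exp (-τ * κ x y)) s T z).re := by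
  have hb := h𝓔.boundedGeometry
  obtain ⟨M, a, y, F, C, hF, hyF, haC, hrow⟩ := T.exists_row_enumeration
  -- the form at the `z`-th row, in an enumeration of the row of length independent of `z`
  let Q : X → ℂ := fun z =>
    ∑ i, ∑ j, star (a i z) * a j z * (Real.exp (-τ * κ (y i z) (y j z)) : ℂ)
  have hQ : ∀ z (s : Finset X), (∀ x, x ∉ s → T.entry z x = 0) →
      rowForm (fun x y => Real.exp (-τ * κ x y)) s T z = Q z := by
    intro z s hs
    have h1 : ∀ x, ∑ x' ∈ s, star (T.entry z x) * T.entry z x' * (Real.exp (-τ * κ x x') : ℂ) =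
        star (T.entry z x * ∑ i, star (a i z * (Real.exp (-τ * κ x (y i z)) : ℂ))) := by
      intro x
      rw [star_mul', star_sum]
      simp only [star_star]
      rw [← hrow z s hs fun x' => (Real.exp (-τ * κ x x') : ℂ), Finset.mul_sum]
      exact Finset.sum_congr rfl fun x' _ => mul_assoc _ _ _
    rw [rowForm, Finset.sum_congr rfl fun x _ => h1 x, ← star_sum, hrow z s hs, star_sum]
    refine Finset.sum_congr rfl fun i _ => ?_
    rw [star_mul', star_sum, Finset.mul_sum]
    exact Finset.sum_congr rfl fun j _ => by rw [star_star, mul_assoc]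
  refine ⟨{z | (Q z).re < -ε}, ?_, fun z hz s hs => ?_⟩
  swap
  · rw [hQ z s hs]
    exact not_lt.1 hz
  by_contra hinf
  have hne : (cofinite ⊓ 𝓟 {z | (Q z).re < -ε}).NeBot :=
    Set.Infinite.cofinite_inf_principal_neBot hinf
  obtain ⟨q, hq⟩ := Ultrafilter.exists_le (cofinite ⊓ 𝓟 {z | (Q z).re < -ε})
  have hqc : (q : Filter X) ≤ cofinite := hq.trans inf_le_left
  have hqQ : ∀ᶠ z in q, (Q z).re < -ε := hq (mem_inf_of_right (mem_principal_self _))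
  set G := relComp (relInv F) F with hG
  have hGc : 𝓔.IsControlled G := 𝓔.comp (𝓔.inv hF) hF
  have hyG : ∀ i j z, (y i z, y j z) ∈ G := fun i j z => ⟨z, hyF i z, hyF j z⟩
  have hcor : ∀ i, q.map (y i) ∈ corona X := fun i => hb.map_mem_corona hF hqc (hyF i)
  have hω : ∀ i j, ∃ E, 𝓔.IsControlled E ∧ (q.map (y i), q.map (y j)) ∈ boundaryClosure E :=
    fun i j => ⟨G, hGc, mem_betaClosure_of_eventually (Eventually.of_forall (hyG i j)),
      hcor i, hcor j⟩
  have hlim : ∀ i, ∃ c, Tendsto (a i) q (𝓝 c) := fun i => by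
    obtain ⟨c, -, hc⟩ := (isCompact_closedBall (0 : ℂ) C).ultrafilter_le_nhds (q.map (a i))
      (tendsto_principal.2 (Eventually.of_forall fun z => mem_closedBall_zero_iff.2 (haC i z)))
    exact ⟨c, hc⟩
  choose c hc using hlim
  have hQlim : Tendsto Q q (𝓝 (∑ i, ∑ j, star (c i) * c j *
      (Real.exp (-τ * (k ⟨q.map (y i), q.map (y j), hω i j⟩ : ℝ)) : ℂ))) := by
    refine tendsto_finsetSum _ fun i _ => tendsto_finsetSum _ fun j _ => ?_
    refine Tendsto.mul ((hc i).star.mul (hc j)) ?_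
    refine (Complex.continuous_ofReal.tendsto _).comp ((Real.continuous_exp.tendsto _).comp
      (Tendsto.const_mul _ ?_))
    exact hκ.tendsto q (y i) (y j) G hGc (Eventually.of_forall (hyG i j)) _ rfl rfl
  have h1 := le_of_tendsto ((Complex.continuous_re.tendsto _).comp hQlim)
    (hqQ.mono fun z hz => hz.le)
  have h2 := hk.re_sum_exp_nonneg _ hω hτ c
  linarith

end CoarseStructure

/-! ### Defects of partial translations -/

namespace PartialTranslation

variable {X : Type u} {𝓔 : CoarseStructure X}

open Classical in
theorem op_entry (t : PartialTranslation 𝓔) (x y : X) :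
    t.op.entry x y = if t.toPEquiv y = some x then 1 else 0 := rfl

/-- A finite sum of indicators of a predicate holding at most once. -/
theorem sum_ite_le_one (s : Finset X) (p : X → Prop) [DecidablePred p]
    (h : ∀ x y, p x → p y → x = y) : ∑ x ∈ s, (if p x then (1 : ℝ) else 0) ≤ 1 := by
  rw [Finset.sum_boole]
  exact_mod_cast Finset.card_le_one.2 fun x hx y hy =>
    h x y (Finset.mem_filter.1 hx).2 (Finset.mem_filter.1 hy).2

variable [h𝓔 : 𝓔.IsSpace]

noncomputable section

/-- The operator `v v* - v`, which measures how far vectors are from being fixed by `v`. -/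
def defect (t : PartialTranslation 𝓔) : TranslationAlgebra 𝓔 := t.op * star t.op - t.op

open Classical in
/-- The row of `v v* - v` at a point `z = t y` of the range is `δ_z - δ_y`. -/
theorem defect_entry_of_eq_some (t : PartialTranslation 𝓔) {z y : X}
    (h : t.toPEquiv y = some z) (x : X) :
    t.defect.entry z x = (if x = z then 1 else 0) - if x = y then 1 else 0 := by
  have h1 : ∀ y', t.toPEquiv y' = some z ↔ y' = y := fun y' =>
    ⟨fun h' => t.toPEquiv.inj h' h, fun h' => h' ▸ h⟩
  have h2 : (t.op * star t.op).entry z x = if x = z then 1 else 0 := by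
    rw [TranslationAlgebra.mul_entry_eq_sum (star t.op) (s := {y})]
    · simp [op_entry, h, eq_comm]
    · intro y' hy'
      rw [op_entry, if_neg]
      rw [h1]
      simpa using hy'
  rw [defect, sub_eq_add_neg, TranslationAlgebra.add_entry, TranslationAlgebra.neg_entry, h2,
    op_entry, ← sub_eq_add_neg]
  simp only [h1]

theorem defect_entry_of_forall_ne (t : PartialTranslation 𝓔) {z : X}
    (h : ∀ y, t.toPEquiv y ≠ some z) (x : X) : t.defect.entry z x = 0 := by
  have h1 : ∀ y, t.op.entry z y = 0 := fun y => by rw [op_entry, if_neg (h y)]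
  rw [defect, sub_eq_add_neg, TranslationAlgebra.add_entry, TranslationAlgebra.neg_entry, h1,
    TranslationAlgebra.mul_entry_eq_sum (star t.op) (s := ∅) (fun y _ => h1 y)]
  simp

open Classical in
theorem norm_defect_entry_le (t : PartialTranslation 𝓔) (z x : X) :
    ‖t.defect.entry z x‖ ≤
      (if x = z then 1 else 0) + if t.toPEquiv x = some z then 1 else 0 := by
  by_cases h : ∃ y, t.toPEquiv y = some z
  · obtain ⟨y, hy⟩ := h
    have h1 : t.toPEquiv x = some z ↔ x = y :=
      ⟨fun h' => t.toPEquiv.inj h' hy, fun h' => h' ▸ hy⟩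
    rw [t.defect_entry_of_eq_some hy, if_congr h1 rfl rfl]
    refine (norm_sub_le _ _).trans (le_of_eq ?_)
    congr 1 <;> split_ifs <;> simp
  · push Not at h
    rw [t.defect_entry_of_forall_ne h, norm_zero]
    positivity

theorem rowNorm_defect_le (t : PartialTranslation 𝓔) : t.defect.rowNorm ≤ 2 := by
  classical
  refine TranslationAlgebra.rowNorm_le zero_le_two fun z s => ?_
  refine (Finset.sum_le_sum fun x _ => t.norm_defect_entry_le z x).trans ?_
  rw [Finset.sum_add_distrib]
  have h1 := sum_ite_le_one s (fun x => x = z) fun x y hx hy => hx.trans hy.symm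
  have h2 := sum_ite_le_one s (fun x => t.toPEquiv x = some z) fun x y hx hy =>
    t.toPEquiv.inj hx hy
  linarith

theorem rowNorm_star_defect_le (t : PartialTranslation 𝓔) : (star t.defect).rowNorm ≤ 2 := by
  classical
  refine TranslationAlgebra.rowNorm_le zero_le_two fun x s => ?_
  have h0 : ∀ z ∈ s, ‖(star t.defect).entry x z‖ ≤
      (if x = z then 1 else 0) + if t.toPEquiv x = some z then 1 else 0 := fun z _ => by
    rw [TranslationAlgebra.star_entry, norm_star]
    exact t.norm_defect_entry_le z x
  refine (Finset.sum_le_sum h0).trans ?_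
  rw [Finset.sum_add_distrib]
  have h1 := sum_ite_le_one s (fun z => x = z) fun y z hy hz => hy.symm.trans hz
  have h2 := sum_ite_le_one s (fun z => t.toPEquiv x = some z) fun y z hy hz =>
    Option.some.inj (hy.symm.trans hz)
  linarith

variable {w : X → X → ℝ}

theorem rowForm_defect_of_eq_some (hsymm : ∀ x y, w x y = w y x) (hdiag : ∀ x, w x x = 1)
    (t : PartialTranslation 𝓔) {z y : X} (h : t.toPEquiv y = some z) {s : Finset X}
    (hz : z ∈ s) (hy : y ∈ s) :
    TranslationAlgebra.rowForm w s t.defect z = (2 - 2 * w z y : ℝ) := by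
  classical
  simp only [TranslationAlgebra.rowForm, t.defect_entry_of_eq_some h]
  have h1 : ∀ g : X → ℂ,
      ∑ x ∈ s, ((if x = z then 1 else 0) - if x = y then 1 else 0 : ℂ) * g x =
      g z - g y := by
    intro g
    simp [sub_mul, Finset.sum_sub_distrib, hz, hy]
  have h2 : ∀ x : X, star ((if x = z then 1 else 0) - if x = y then 1 else 0 : ℂ) =
      (if x = z then 1 else 0) - if x = y then 1 else 0 := by
    intro x
    split_ifs <;> simp
  simp only [h2, mul_assoc, ← Finset.mul_sum]
  rw [h1]
  simp only [h1, hdiag, hsymm y z]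
  push_cast
  ring

theorem rowForm_defect_of_forall_ne (t : PartialTranslation 𝓔) {z : X}
    (h : ∀ y, t.toPEquiv y ≠ some z) (s : Finset X) :
    TranslationAlgebra.rowForm w s t.defect z = 0 := by
  simp [TranslationAlgebra.rowForm, t.defect_entry_of_forall_ne h]

end

end PartialTranslation

/-! ### The limit state -/

namespace CoarseStructure

variable {X : Type u} {𝓔 : CoarseStructure X}

namespace SplitsIntoFiniteComponents

variable {Y : ℕ → Set X}

theorem entry_eq_zero (hY : 𝓔.SplitsIntoFiniteComponents Y) (T : TranslationAlgebra 𝓔) {n : ℕ}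
    {x z : X} (hx : x ∈ Y n) (hz : z ∉ Y n) : T.entry x z = 0 ∧ T.entry z x = 0 := by
  constructor <;> by_contra hne
  · exact hz (hY.mem_of_mem_controlled T.controlled hx hne)
  · exact hz (hY.mem_of_mem_controlled (𝓔.inv T.controlled) hx hne)

variable [h𝓔 : 𝓔.IsSpace]

theorem re_schurAverage_star_mul_self (hY : 𝓔.SplitsIntoFiniteComponents Y) (w : X → X → ℝ)
    (T : TranslationAlgebra 𝓔) (n : ℕ) :
    (TranslationAlgebra.schurAverage w (hY.finite n).toFinset (star T * T)).re =
      ((hY.finite n).toFinset.card : ℝ)⁻¹ * ∑ z ∈ (hY.finite n).toFinset,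
        (TranslationAlgebra.rowForm w (hY.finite n).toFinset T z).re := by
  rw [TranslationAlgebra.schurAverage_star_mul_self _ _ fun x hx z hz =>
    (hY.entry_eq_zero T (by simpa using hx) (by simpa using hz)).2,
    ← Complex.ofReal_natCast, ← Complex.ofReal_inv, Complex.re_ofReal_mul, Complex.re_sum]

/-- The limit of the averages over the components, along a non-principal ultrafilter, of the Schur
products with the kernel `exp (-τ κ)`. It is positive since the errors in `finite_rowForm_lt` occur
in finitely many components only. -/
theorem exists_limit_functional (hY : 𝓔.SplitsIntoFiniteComponents Y) {k : 𝓔.Boundary → ℝ≥0}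
    (hk : 𝓔.IsProperNegativeTypeKernel k) {κ : X → X → ℝ} (hκ : IsExtensionOf κ k) {τ : ℝ}
    (hτ : 0 ≤ τ) :
    ∃ φ : DominatedPositiveFunctional (TranslationAlgebra 𝓔),
      φ.size = TranslationAlgebra.rowNorm ∧
      ∀ T, Tendsto (fun n => TranslationAlgebra.schurAverage (fun x y => Real.exp (-τ * κ x y))
        (hY.finite n).toFinset T) (hyperfilter ℕ) (𝓝 (φ.toLinear T)) := by
  set w : X → X → ℝ := fun x y => Real.exp (-τ * κ x y) with hw
  have hw1 : ∀ x y, |w x y| ≤ 1 := fun x y => by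
    rw [abs_of_nonneg (Real.exp_nonneg _), Real.exp_le_one_iff, neg_mul, neg_nonpos]
    exact mul_nonneg hτ (hκ.nonneg x y)
  have hws : ∀ x y, w x y = w y x := fun x y => by simp only [hw, hκ.symm x y]
  have hlim : ∀ T : TranslationAlgebra 𝓔, ∃ c, Tendsto (fun n =>
      TranslationAlgebra.schurAverage w (hY.finite n).toFinset T) (hyperfilter ℕ) (𝓝 c) := by
    intro T
    obtain ⟨c, -, hc⟩ := (isCompact_closedBall (0 : ℂ) T.rowNorm).ultrafilter_le_nhds
      ((hyperfilter ℕ).map fun n => TranslationAlgebra.schurAverage w (hY.finite n).toFinset T)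
      (tendsto_principal.2 (Eventually.of_forall fun n =>
        mem_closedBall_zero_iff.2 (TranslationAlgebra.norm_schurAverage_le hw1 _ T)))
    exact ⟨c, hc⟩
  choose φ hφ using hlim
  refine ⟨{ toLinear := ⟨⟨φ, fun S T => ?_⟩, fun c T => ?_⟩
            size := TranslationAlgebra.rowNorm
            map_star := fun T => ?_
            nonneg := fun T => ?_
            norm_le_size := fun T => ?_
            size_mul_le := TranslationAlgebra.rowNorm_mul_le }, rfl, hφ⟩
  · refine tendsto_nhds_unique (hφ (S + T)) (((hφ S).add (hφ T)).congr fun n => ?_)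
    simp only [TranslationAlgebra.schurAverage, TranslationAlgebra.add_entry, add_mul,
      Finset.sum_add_distrib, mul_add]
  · refine tendsto_nhds_unique (hφ (c • T)) (((hφ T).const_mul c).congr fun n => ?_)
    simp only [TranslationAlgebra.schurAverage, TranslationAlgebra.smul_entry, mul_assoc,
      ← Finset.mul_sum]
    exact mul_left_comm _ _ _
  · exact tendsto_nhds_unique (hφ (star T)) ((hφ T).star.congr fun n =>
      (TranslationAlgebra.schurAverage_star hws _ T).symm)
  · change 0 ≤ (φ (star T * T)).re
    have hre := (Complex.continuous_re.tendsto _).comp (hφ (star T * T))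
    refine le_of_forall_pos_le_add fun ε hε => ?_
    obtain ⟨B, hB, hBT⟩ := hk.finite_rowForm_lt hκ hτ T hε
    have hev : ∀ᶠ n in (hyperfilter ℕ : Filter ℕ), ∀ x ∈ Y n, x ∉ B :=
      Nat.hyperfilter_le_atTop (hY.eventually_notMem hB)
    have : -ε ≤ (φ (star T * T)).re := by
      refine ge_of_tendsto hre ?_
      filter_upwards [hev] with n hn
      rw [Function.comp_apply, hY.re_schurAverage_star_mul_self]
      have hsum : (hY.finite n).toFinset.card • (-ε) ≤ ∑ z ∈ (hY.finite n).toFinset,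
          (TranslationAlgebra.rowForm w (hY.finite n).toFinset T z).re := by
        refine Finset.card_nsmul_le_sum _ _ _ fun z hz => ?_
        have hzY : z ∈ Y n := by simpa using hz
        exact hBT z (hn z hzY) _ fun x hx => (hY.entry_eq_zero T hzY (by simpa using hx)).1
      rcases Nat.eq_zero_or_pos (hY.finite n).toFinset.card with h0 | h0
      · rw [h0]
        simp [hε.le]
      · rw [nsmul_eq_mul] at hsum
        rw [← div_eq_inv_mul, le_div_iff₀ (by exact_mod_cast h0), mul_comm]
        exact hsum
    linarith
  · exact le_of_tendsto (hφ T).norm (Eventually.of_forall fun n =>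
      TranslationAlgebra.norm_schurAverage_le hw1 _ T)

/-- The row of the defect of `t` at `t y = z` contributes `2 - 2 * w z y`, the other rows
vanish. -/
theorem re_rowForm_defect (hY : 𝓔.SplitsIntoFiniteComponents Y) {w : X → X → ℝ}
    (hsymm : ∀ x y, w x y = w y x) (hdiag : ∀ x, w x x = 1) (t : PartialTranslation 𝓔) {n : ℕ}
    {z y : X} (hz : z ∈ (hY.finite n).toFinset) (hy : t.toPEquiv y = some z) :
    (TranslationAlgebra.rowForm w (hY.finite n).toFinset t.defect z).re = 2 - 2 * w z y := by
  rw [t.rowForm_defect_of_eq_some hsymm hdiag hy hz, Complex.ofReal_re]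
  rw [Finite.mem_toFinset] at hz ⊢
  exact hY.mem_of_mem_controlled t.controlled hz hy

theorem re_schurAverage_defect_le (hY : 𝓔.SplitsIntoFiniteComponents Y) {w : X → X → ℝ}
    (hsymm : ∀ x y, w x y = w y x) (hdiag : ∀ x, w x x = 1) (t : PartialTranslation 𝓔) (n : ℕ)
    {D : ℝ} (hD : 0 ≤ D) (h : ∀ z y, t.toPEquiv y = some z → 2 - 2 * w z y ≤ D) :
    (TranslationAlgebra.schurAverage w (hY.finite n).toFinset (star t.defect * t.defect)).re
      ≤ D := by
  rw [hY.re_schurAverage_star_mul_self]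
  set s := (hY.finite n).toFinset
  have hsum : ∑ z ∈ s, (TranslationAlgebra.rowForm w s t.defect z).re ≤ s.card • D := by
    refine Finset.sum_le_card_nsmul _ _ _ fun z hz => ?_
    by_cases hy : ∃ y, t.toPEquiv y = some z
    · obtain ⟨y, hy⟩ := hy
      rw [hY.re_rowForm_defect hsymm hdiag t hz hy]
      exact h z y hy
    · push Not at hy
      rw [t.rowForm_defect_of_forall_ne hy, Complex.zero_re]
      exact hD
  rw [nsmul_eq_mul] at hsum
  rcases Nat.eq_zero_or_pos s.card with h0 | h0
  · rw [h0]
    simpa using hD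
  · rwa [inv_mul_le_iff₀ (by exact_mod_cast h0)]

theorem le_re_schurAverage_defect (hY : 𝓔.SplitsIntoFiniteComponents Y) {w : X → X → ℝ}
    (hsymm : ∀ x y, w x y = w y x) (hdiag : ∀ x, w x x = 1) (t : PartialTranslation 𝓔) {n : ℕ}
    (hne : (Y n).Nonempty)
    (hcard : (Y n).ncard ≤ 2 * {x ∈ Y n | ∃ y, t.toPEquiv y = some x}.ncard)
    {D : ℝ} (hD : 0 ≤ D) (h : ∀ z ∈ Y n, ∀ y, t.toPEquiv y = some z → D ≤ 2 - 2 * w z y) :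
    D / 2 ≤
      (TranslationAlgebra.schurAverage w (hY.finite n).toFinset (star t.defect * t.defect)).re := by
  classical
  rw [hY.re_schurAverage_star_mul_self]
  set s := (hY.finite n).toFinset with hs
  have hmem : ∀ x, x ∈ s ↔ x ∈ Y n := fun x => by simp [hs]
  have hcs : (Y n).ncard = s.card := ncard_eq_toFinset_card _ _
  have h0 : 0 < s.card := by
    rw [← hcs]
    exact (ncard_pos (hY.finite n)).2 hne
  have hcr : {x ∈ Y n | ∃ y, t.toPEquiv y = some x}.ncard =
      (s.filter fun x => ∃ y, t.toPEquiv y = some x).card := by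
    rw [← ncard_coe_finset]
    congr 1
    ext x
    simp [hmem]
  have hsum : (s.filter fun x => ∃ y, t.toPEquiv y = some x).card • D ≤
      ∑ z ∈ s, (TranslationAlgebra.rowForm w s t.defect z).re := by
    rw [← Finset.sum_filter_add_sum_filter_not s fun x => ∃ y, t.toPEquiv y = some x]
    refine (Finset.card_nsmul_le_sum _ _ D fun z hz => ?_).trans
      (le_add_of_nonneg_right (Finset.sum_nonneg fun z hz => ?_))
    · obtain ⟨hzs, y, hy⟩ := Finset.mem_filter.1 hz
      rw [hY.re_rowForm_defect hsymm hdiag t hzs hy]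
      exact h z ((hmem z).1 hzs) y hy
    · have hz2 := (Finset.mem_filter.1 hz).2
      push Not at hz2
      rw [t.rowForm_defect_of_forall_ne hz2, Complex.zero_re]
  rw [← div_eq_inv_mul, le_div_iff₀ (by exact_mod_cast h0)]
  refine le_trans ?_ hsum
  rw [hcs, hcr] at hcard
  rw [nsmul_eq_mul]
  have : (s.card : ℝ) ≤ 2 * (s.filter fun x => ∃ y, t.toPEquiv y = some x).card := by
    exact_mod_cast hcard
  nlinarith

end SplitsIntoFiniteComponents

end CoarseStructure

/-! ### Properness of the kernel -/

namespace CoarseStructure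

variable {X : Type u} {𝓔 : CoarseStructure X}

/-- Properness in terms of a single controlled set for each bound. -/
theorem IsProperNegativeTypeKernel.exists_forall_lt {k : 𝓔.Boundary → ℝ≥0}
    (hk : 𝓔.IsProperNegativeTypeKernel k) (R : ℝ≥0) :
    ∃ E, 𝓔.IsControlled E ∧ ∀ p : 𝓔.Boundary, (p.fst, p.snd) ∉ boundaryClosure E → R < k p := by
  have : Nonempty 𝓔.Controlled := ⟨⟨_, 𝓔.diag⟩⟩
  have : IsDirectedOrder 𝓔.Controlled := ⟨fun E F =>
    ⟨⟨E.1 ∪ F.1, 𝓔.union E.2 F.2⟩, subset_union_left, subset_union_right⟩⟩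
  obtain ⟨E, hE⟩ := (hk.proper.eventually (lt_mem_nhds (ENNReal.coe_lt_top (r := R)))).exists
  refine ⟨E.1, E.2, fun p hp => ?_⟩
  exact_mod_cast hE.trans_le
    (iInf_le (fun p : {p : 𝓔.Boundary // (p.fst, p.snd) ∉ boundaryClosure E.1} =>
      (k p.1 : ℝ≥0∞)) ⟨p, hp⟩)

variable [h𝓔 : 𝓔.IsSpace]

/-- A partial translation whose graph is disjoint from a large controlled set moves all but
finitely many points to points where the kernel is large. -/
theorem IsExtensionOf.finite_lt {k : 𝓔.Boundary → ℝ≥0} {κ : X → X → ℝ}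
    (hκ : IsExtensionOf κ k) {R : ℝ≥0} {E : Set (X × X)} (hE : 𝓔.IsControlled E)
    (hR : ∀ p : 𝓔.Boundary, (p.fst, p.snd) ∉ boundaryClosure E → R < k p)
    (t : PartialTranslation 𝓔) (ht : ∀ x y, t.toPEquiv y = some x → (x, y) ∉ E) :
    {z | ∃ y, t.toPEquiv y = some z ∧ κ z y < R}.Finite := by
  have hb := h𝓔.boundedGeometry
  by_contra hinf
  set B := {z | ∃ y, t.toPEquiv y = some z ∧ κ z y < R} with hB
  have hne : (cofinite ⊓ 𝓟 B).NeBot := Set.Infinite.cofinite_inf_principal_neBot hinf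
  obtain ⟨q, hq⟩ := Ultrafilter.exists_le (cofinite ⊓ 𝓟 B)
  have hqc : (q : Filter X) ≤ cofinite := hq.trans inf_le_left
  have hqB : ∀ᶠ z in q, z ∈ B := hq (mem_inf_of_right (mem_principal_self _))
  have hg : ∀ z, ∃ y, (z ∈ B → t.toPEquiv y = some z ∧ κ z y < R) ∧ (z ∉ B → y = z) := by
    intro z
    by_cases hz : z ∈ B
    · obtain ⟨y, hy⟩ := hz
      exact ⟨y, fun _ => hy, fun h => absurd ⟨y, hy⟩ h⟩
    · exact ⟨z, fun h => absurd h hz, fun _ => rfl⟩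
  choose g hg1 hg2 using hg
  set F : Set (X × X) := {p | t.toPEquiv p.2 = some p.1} ∪ {p | p.1 = p.2} with hF
  have hFc : 𝓔.IsControlled F := 𝓔.union t.controlled 𝓔.diag
  have hgF : ∀ z, (z, g z) ∈ F := fun z => by
    by_cases hz : z ∈ B
    · exact Or.inl (hg1 z hz).1
    · exact Or.inr (hg2 z hz).symm
  have hcl : (q.map id, q.map g) ∈ boundaryClosure F :=
    ⟨mem_betaClosure_of_eventually (Eventually.of_forall hgF),
      hb.map_mem_corona (f := id) 𝓔.diag hqc fun _ => rfl, hb.map_mem_corona hFc hqc hgF⟩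
  let p : 𝓔.Boundary := ⟨q.map id, q.map g, F, hFc, hcl⟩
  have hp : R < k p := hR p fun h =>
    hb.notMem_betaClosure t hE ht (f := id) (hqB.mono fun z hz => (hg1 z hz).1) h.1
  have hlim := hκ.tendsto q id g F hFc (Eventually.of_forall hgF) p rfl rfl
  have hle : ((k p : ℝ≥0) : ℝ) ≤ R :=
    le_of_tendsto hlim (hqB.mono fun z hz => (hg1 z hz).2.le)
  exact absurd (NNReal.coe_le_coe.1 hle) (not_le.2 hp)

end CoarseStructure

/-! ### Constant vectors and the contradiction -/

section Constant

variable {X : Type u} {𝓔 : CoarseStructure X} [𝓔.IsSpace]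
  {H : Type u} [NormedAddCommGroup H] [InnerProductSpace ℂ H] [CompleteSpace H]

theorem map_defect_eq_zero_of_mem_constantVectors
    (π : TranslationAlgebra 𝓔 →⋆ₐ[ℂ] (H →L[ℂ] H)) {ξ : H} (hξ : ξ ∈ constantVectors π)
    (t : PartialTranslation 𝓔) : π t.defect ξ = 0 := by
  rw [PartialTranslation.defect, map_sub, sub_apply, sub_eq_zero]
  exact (hξ t).symm

theorem isClosed_constantVectors (π : TranslationAlgebra 𝓔 →⋆ₐ[ℂ] (H →L[ℂ] H)) :
    IsClosed (constantVectors π : Set H) := by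
  have : (constantVectors π : Set H) =
      ⋂ t : PartialTranslation 𝓔, {ξ | π t.op ξ = π (t.op * star t.op) ξ} := by
    ext ξ
    simp only [mem_iInter]
    rfl
  rw [this]
  exact isClosed_iInter fun t => isClosed_eq (by fun_prop) (by fun_prop)

/-- Subtracting the constant part of a vector does not change its defects. -/
theorem exists_mem_orthogonal_constantVectors (π : TranslationAlgebra 𝓔 →⋆ₐ[ℂ] (H →L[ℂ] H))
    (ξ : H) : ∃ ζ ∈ (constantVectors π)ᗮ, ∀ t : PartialTranslation 𝓔,
      π t.defect ζ = π t.defect ξ := by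
  have : CompleteSpace (constantVectors π) := (isClosed_constantVectors π).completeSpace_coe
  obtain ⟨η, hη, ζ, hζ, rfl⟩ := (constantVectors π).exists_add_mem_mem_orthogonal ξ
  refine ⟨ζ, hζ, fun t => ?_⟩
  rw [map_add, map_defect_eq_zero_of_mem_constantVectors π hη, zero_add]

end Constant

theorem mainTheorem3 {X : Type u} (𝓔 : CoarseStructure X) [𝓔.IsSpace] (Y : ℕ → Set X)
    (hY : 𝓔.SplitsIntoFiniteComponents Y) (hX : 𝓔.BoundaryATMenable) :
    ¬ GeometricPropertyT 𝓔 := by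
  intro hT
  have hsp : 𝓔.IsSpace := inferInstance
  obtain ⟨k, hk⟩ := hX
  obtain ⟨κ, hκ⟩ := hk.exists_isExtensionOf hsp.monogenic
  obtain ⟨E, hE⟩ := hsp.monogenic
  obtain ⟨c, hc, hgap⟩ := hT E hE
  obtain ⟨C, hC⟩ := hκ.bounded E hE.1
  -- small enough for `2 τ κ ≤ (c / 4) ^ 2` on the generating set
  set τ : ℝ := c ^ 2 / (32 * (|C| + 1)) with hτdef
  have hτ : 0 < τ := by positivity
  set w : X → X → ℝ := fun x y => Real.exp (-τ * κ x y) with hw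
  have hws : ∀ x y, w x y = w y x := fun x y => by simp only [hw, hκ.symm x y]
  have hwd : ∀ x, w x x = 1 := fun x => by simp only [hw, hκ.diag, mul_zero, Real.exp_zero]
  obtain ⟨φ, hφsize, hφ⟩ := hY.exists_limit_functional hk hκ hτ.le
  have hre : ∀ t : PartialTranslation 𝓔, Tendsto (fun n => (TranslationAlgebra.schurAverage w
      (hY.finite n).toFinset (star t.defect * t.defect)).re) (hyperfilter ℕ)
      (𝓝 (‖φ.rep t.defect φ.cyclicVector‖ ^ 2)) := fun t => by
    rw [φ.norm_rep_cyclicVector_sq]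
    exact (Complex.continuous_re.tendsto _).comp (hφ _)
  obtain ⟨ζ, hζ, hζeq⟩ := exists_mem_orthogonal_constantVectors φ.rep φ.cyclicVector
  -- the cyclic vector is almost invariant, hence close to its constant part
  have hsmall : ‖ζ‖ ≤ 1 / 4 := by
    obtain ⟨t, htE, ht⟩ := hgap _ φ.rep ζ hζ
    change c * ‖ζ‖ ≤ ‖φ.rep t.defect ζ‖ at ht
    rw [hζeq t] at ht
    have h1 : ‖φ.rep t.defect φ.cyclicVector‖ ^ 2 ≤ (c / 4) ^ 2 := by
      refine le_of_tendsto (hre t) (Eventually.of_forall fun n =>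
        hY.re_schurAverage_defect_le hws hwd t n (by positivity) fun z y hzy => ?_)
      have hzE : (z, y) ∈ E := htE (by
        change t.op.entry z y ≠ 0
        rw [PartialTranslation.op_entry, if_pos hzy]
        exact one_ne_zero)
      have h2 : κ z y ≤ |C| := (hC z y hzE).trans (le_abs_self C)
      have h3 := Real.add_one_le_exp (-τ * κ z y)
      have h4 : τ * κ z y ≤ τ * (|C| + 1) := mul_le_mul_of_nonneg_left (by linarith) hτ.le
      have h5 : τ * (|C| + 1) = c ^ 2 / 32 := by
        rw [hτdef]
        field_simp
      simp only [hw]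
      nlinarith
    have h2 := abs_le_of_sq_le_sq' h1 (by positivity) |>.2
    nlinarith
  -- where `κ ≥ 2 / τ` the kernel `exp (-τ κ)` is at most `exp (-2)`, so that a partial
  -- translation moving many points far away has a large defect on the cyclic vector
  obtain ⟨E₁, hE₁, hfar⟩ := hk.exists_forall_lt (Real.toNNReal (2 / τ))
  obtain ⟨t, htE₁, htlarge⟩ :=
    hY.exists_far_partialTranslation hsp.boundedGeometry hsp.monogenic hE₁
  have hfin := hκ.finite_lt hE₁ hfar t htE₁
  have hlarge : (3 / 4 : ℝ) ≤ ‖φ.rep t.defect φ.cyclicVector‖ ^ 2 := by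
    refine ge_of_tendsto (hre t) ?_
    filter_upwards [Nat.hyperfilter_le_atTop htlarge,
      Nat.hyperfilter_le_atTop (hY.eventually_notMem hfin)] with n hn1 hn2
    have hne : (Y n).Nonempty := by
      obtain ⟨x, hx⟩ := hY.isComponent n
      rw [hx]
      exact ⟨x, 𝓔.subset 𝓔.diag (singleton_subset_iff.2 rfl)⟩
    have := hY.le_re_schurAverage_defect hws hwd t hne hn1 (D := 3 / 2) (by norm_num)
      fun z hz y hzy => ?_
    · linarith
    · have h1 : 2 / τ ≤ κ z y := by
        by_contra! hlt
        refine hn2 z hz ⟨y, hzy, ?_⟩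
        rwa [Real.coe_toNNReal _ (by positivity)]
      have h2 : 2 ≤ τ * κ z y := by
        rw [div_le_iff₀ hτ] at h1
        linarith
      -- `exp (-2) ≤ 1 / 4`
      have h3 : w z y ≤ 1 / 4 := by
        have h4 : Real.exp 2 = Real.exp 1 ^ 2 := by rw [← Real.exp_nat_mul]; norm_num
        have h5 : (2 : ℝ) ≤ Real.exp 1 := by linarith [Real.add_one_le_exp (1 : ℝ)]
        have h6 : (4 : ℝ) ≤ Real.exp (τ * κ z y) := by
          refine le_trans ?_ (Real.exp_le_exp.2 h2)
          rw [h4]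
          nlinarith
        simp only [hw, neg_mul, Real.exp_neg]
        rw [one_div]
        exact inv_anti₀ (by norm_num) h6
      linarith
  -- but defects are operators of norm at most `2`, and only see the small vector `ζ`
  have hbound := φ.norm_rep_sq_le t.defect ζ
  rw [hζeq t, hφsize] at hbound
  have hsize : (star t.defect * t.defect).rowNorm ≤ 2 * 2 :=
    (TranslationAlgebra.rowNorm_mul_le _ _).trans
      (mul_le_mul t.rowNorm_star_defect_le t.rowNorm_defect_le t.defect.rowNorm_bounds.1
        zero_le_two)
  have h1 : ‖ζ‖ ^ 2 ≤ (1 / 4) ^ 2 := pow_le_pow_left₀ (norm_nonneg _) hsmall 2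
  have h2 := mul_le_mul hsize h1 (sq_nonneg _) (by norm_num)
  linarith
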